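/- **Setting.** Let $\mathbb{T}$ be a finite rooted tree. For a node $u$ let $\mathbb{T}_u$ be the sub-tree formed by $u$ and its descendants and $\mathcal{C}_u$ the set of children of $u$. Let $(E_v)_{v\in\mathbb{T}}$ be measurable spaces and put $\mathbf{E}_u:=\prod_{v\in\mathbb{T}_u}E_v$ and $\mathbf{E}_{\mathcal{C}_u}:=\prod_{v\in\mathbb{T}_u\setminus\{u\}}E_v=\prod_{v\in\mathcal{C}_u}\mathbf{E}_v$, with the product $\sigma$-algebras. We are given - finite measures $\rho_u$ on $\mathbf{E}_u$ for every node $u$ (the targets), with $Z_u:=\rho_u(\mathbf{E}_u)$ and $\mu_u:=\rho_u/Z_u$; - finite measures $\gamma_{u_-}$ on $\mathbf{E}_{\mathcal{C}_u}$ for every node $u$ that is not a leaf (the auxiliary measures); - a probability measure $K_u$ on $E_u$ for every leaf $u$, and a Markov kernel $K_u$ from $\mathbf{E}_{\mathcal{C}_u}$ to $E_u$ for every other node $u$. Put $\gamma_u:=K_u$ if $u$ is a leaf and $\gamma_u:=\gamma_{u_-}\otimes K_u$ otherwise, and $\gamma_{\mathcal{C}_u}:=\prod_{v\in\mathcal{C}_u}\gamma_v$.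 **Assumptions.** (1) For every node $u$ and every non-leaf $v$, $\rho_u\ll\gamma_u$ and $\gamma_{v_-}\ll\gamma_{\mathcal{C}_v}$, with Radon–Nikodym derivatives (fixed measurable versions) $w_u=d\rho_u/d\gamma_u$ and $w_{v_-}=d\gamma_{v_-}/d\gamma_{\mathcal{C}_v}$ that are real-valued and positive everywhere. (2) All the functions $w_u$ and $w_{v_-}$ are bounded. **Algorithm.** For an integer $N>0$, the divide-and-conquer sequential Monte Carlo algorithm called at a node $u$ returns a random measure $\gamma_u^N=\frac{\mathcal{Z}_u^N}{N}\sum_{n=1}^N\delta_{\mathbf{X}_u^{n,N}}$ on $\mathbf{E}_u$, as follows. If $u$ is a leaf, then $\mathcal{Z}_u^N=1$ and $\mathbf{X}_u^{1,N},\dots,\mathbf{X}_u^{N,N}$ are drawn independently from $K_u$. Otherwise the algorithm calls itself independently at each child $v$ of $u$, which yields $(\gamma_v^N)_{v\in\mathcal{C}_u}$; it sets $\gamma_{u_-}^N(d\mathbf{x}):=w_{u_-}(\mathbf{x})\prod_{v\in\mathcal{C}_u}\gamma_v^N(d\mathbf{x})$ and $\mathcal{Z}_u^N:=\gamma_{u_-}^N(\mathbf{E}_{\mathcal{C}_u})$;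 it draws $\mathbf{X}_{u_-}^{1,N},\dots,\mathbf{X}_{u_-}^{N,N}$ independently from $\gamma_{u_-}^N/\mathcal{Z}_u^N$, then draws $X_u^{n,N}$ independently from $K_u(\mathbf{X}_{u_-}^{n,N},\cdot)$ for $n\le N$, and sets $\mathbf{X}_u^{n,N}:=(X_u^{n,N},\mathbf{X}_{u_-}^{n,N})$. The estimators are $$\rho_u^N(d\mathbf{x}):=w_u(\mathbf{x})\gamma_u^N(d\mathbf{x}),\qquad Z_u^N:=\rho_u^N(\mathbf{E}_u),\qquad \mu_u^N:=\rho_u^N/Z_u^N .$$ **Theorem ($L^p$ inequalities).** Under Assumptions (1) and (2), for each real $p\ge1$ and each node $u$ there exist constants $C_u^\rho,C_u^\mu<\infty$ such that $$\mathbb{E}\big[|\rho_u^N(\varphi)-\rho_u(\varphi)|^p\big]^{1/p}\le\frac{C_u^\rho\|\varphi\|}{N^{1/2}},\qquad \mathbb{E}\big[|\mu_u^N(\varphi)-\mu_u(\varphi)|^p\big]^{1/p}\le\frac{C_u^\mu\|\varphi\|}{N^{1/2}}$$ for all integers $N>0$ and all bounded measurable $\varphi:\mathbf{E}_u\to\mathbb{R}$,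 where $\|\varphi\|:=\sup_{\mathbf{x}}|\varphi(\mathbf{x})|$ and $\nu(\varphi):=\int\varphi\,d\nu$. In particular, $\mathbb{E}[|Z_u^N-Z_u|^p]^{1/p}\le C_u^\rho/N^{1/2}$ for all integers $N>0$. -/

import Mathlib

open MeasureTheory ProbabilityTheory
open scoped NNReal ENNReal

noncomputable section

namespace DaC

/-! ### Trees and the product spaces indexed by them

A finite rooted tree is a `RootedTree` whose type of nodes is finite. It is ordered by ancestry:
the root is `⊥`, `u ≤ v` says that `v` is `u` or one of its descendants, `u ⋖ v` says that `v`
is a child of `u`, and the leaves are the maximal elements (`IsMax`). -/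

/-- The children of the node `u`. -/
abbrev Children {T : RootedTree} (u : T) : Type _ := {v : T // u ⋖ v}

instance {T : RootedTree} [Finite T] (u : T) : Fintype (Children u) := Fintype.ofFinite _

/-- `∏ E_v` over the nodes `v` of the sub-tree rooted at `u`. -/
abbrev SubtreeSpace {T : RootedTree} (E : T → Type*) (u : T) : Type _ := ∀ v : Set.Ici u, E v

/-- `∏ E_v` over the nodes `v ≠ u` of the sub-tree rooted at `u`. A single point if `u` is
a leaf. -/
abbrev BelowSpace {T : RootedTree} (E : T → Type*) (u : T) : Type _ := ∀ v : Set.Ioi u, E v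

section Spaces

variable {T : RootedTree} {E : T → Type*}

lemma exists_child [Finite T] (u : T) (w : Set.Ioi u) : ∃ v : Children u, v.1 ≤ w := by
  obtain ⟨v, hv, hvw⟩ := exists_covBy_le_of_lt (Set.mem_Ioi.1 w.2)
  exact ⟨⟨v, hv⟩, hvw⟩

/-- The child of `u` that is an ancestor of (or equal to) the strict descendant `w` of `u`. -/
def childToward [Finite T] (u : T) (w : Set.Ioi u) : Children u := (exists_child u w).choose

lemma childToward_le [Finite T] (u : T) (w : Set.Ioi u) : (childToward u w).1 ≤ w :=
  (exists_child u w).choose_spec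

/-- That child is unique. -/
lemma eq_childToward [Finite T] (u : T) (w : Set.Ioi u) (v : Children u) (hv : v.1 ≤ w) :
    v = childToward u w := by
  have hw := childToward_le u w
  rcases le_total_of_directed hv hw with h | h
  · exact Subtype.ext (h.eq_or_lt.resolve_right fun hlt =>
      v.2.2 (childToward u w).2.lt hlt).symm
  · exact Subtype.ext (h.eq_or_lt.resolve_right fun hlt =>
      (childToward u w).2.2 v.2.lt hlt)

/-- The identification of `∏_{v child of u} SubtreeSpace E v` with `BelowSpace E u`. -/
def glue [Finite T] (u : T) (y : ∀ v : Children u, SubtreeSpace E v.1) : BelowSpace E u :=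
  fun w => y (childToward u w) ⟨w, childToward_le u w⟩

/-- For a child `v` of `u`, the coordinates of `glue u y` below `v` are those of `y v`. -/
lemma glue_apply [Finite T] (u : T) (y : ∀ v : Children u, SubtreeSpace E v.1) (v : Children u)
    (w : Set.Ici v.1) : glue u y ⟨w, lt_of_lt_of_le v.2.lt w.2⟩ = y v w := by
  have key : ∀ (v' : Children u) (_ : v = v') (hw : v'.1 ≤ w), y v' ⟨w, hw⟩ = y v w := by
    rintro _ rfl _
    rfl
  exact key _ (eq_childToward u ⟨w, lt_of_lt_of_le v.2.lt w.2⟩ v w.2) _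

/-- The identification of `BelowSpace E u × E u` with `SubtreeSpace E u`. -/
def join (u : T) (p : BelowSpace E u × E u) : SubtreeSpace E u := by
  classical
  exact fun w => if h : u = w then h ▸ p.2 else p.1 ⟨w, lt_of_le_of_ne w.2 h⟩

/-- The only point of `BelowSpace E u` when `u` is a leaf. -/
def leafPoint {u : T} (hu : IsMax u) : BelowSpace E u := fun w => absurd w.2 hu.not_lt

end Spaces

/-- The measure `w(x) μ(dx)`. -/
def reweigh {X : Type*} [MeasurableSpace X] (w : X → ℝ) (μ : Measure X) : Measure X :=
  μ.withDensity fun x => ENNReal.ofReal (w x)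

/-- The measure `μ` divided by its total mass. -/
def normalized {X : Type*} [MeasurableSpace X] (μ : Measure X) : Measure X :=
  (μ Set.univ)⁻¹ • μ

/-- The supremum norm. -/
def supNorm {X : Type*} (φ : X → ℝ) : ℝ := ⨆ x, |φ x|

/-- A bounded measurable real-valued function. -/
def IsBddMeasurable {X : Type*} [MeasurableSpace X] (φ : X → ℝ) : Prop :=
  Measurable φ ∧ BddAbove (Set.range fun x => |φ x|)

/-! ### The problem data -/

/-- The ingredients of divide-and-conquer sequential Monte Carlo on a finite rooted tree. For a
leaf `u` the kernel `K u` starts from a one-point space, so it is a probability distribution on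
`E u`, and the values of `aux` and `wAux` at `u` are never used. -/
structure Model (T : RootedTree) [Finite T] (E : T → Type*) [∀ u, MeasurableSpace (E u)] where
  /-- the targets `ρ_u` -/
  ρ : ∀ u, Measure (SubtreeSpace E u)
  finite_ρ : ∀ u, IsFiniteMeasure (ρ u)
  /-- the auxiliary measures `γ_{u_-}` -/
  aux : ∀ u, Measure (BelowSpace E u)
  finite_aux : ∀ u, IsFiniteMeasure (aux u)
  /-- the proposal kernels `K_u` -/
  K : ∀ u, Kernel (BelowSpace E u) (E u)
  markov_K : ∀ u, IsMarkovKernel (K u)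
  /-- the weight functions `w_u` -/
  w : ∀ u, SubtreeSpace E u → ℝ
  measurable_w : ∀ u, Measurable (w u)
  /-- the weight functions `w_{u_-}` -/
  wAux : ∀ u, BelowSpace E u → ℝ
  measurable_wAux : ∀ u, Measurable (wAux u)

/-- What a call of the algorithm at `u` with `N` particles returns: the total mass `𝒵_u^N` and
the particles `X_u^{1,N}, …, X_u^{N,N}`, which together encode
`γ_u^N = N⁻¹ 𝒵_u^N ∑ₙ δ_{X_u^{n,N}}`. -/
abbrev Output {T : RootedTree} (E : T → Type*) (N : ℕ) (u : T) : Type _ :=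
  ℝ≥0 × (Fin N → SubtreeSpace E u)

/-- The weighted empirical measure `γ_u^N = N⁻¹ 𝒵_u^N ∑ₙ δ_{X_u^{n,N}}`. -/
def gammaN {T : RootedTree} {E : T → Type*} [∀ u, MeasurableSpace (E u)] {N : ℕ} {u : T}
    (o : Output E N u) : Measure (SubtreeSpace E u) :=
  ((o.1 : ℝ≥0∞) / N) • ∑ n, Measure.dirac (o.2 n)

namespace Model

variable {T : RootedTree} [Finite T] {E : T → Type*} [∀ u, MeasurableSpace (E u)]

/-- The extended auxiliary measure: `γ_u = K_u` if `u` is a leaf, and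
`γ_u = γ_{u_-} ⊗ K_u` otherwise. -/
def gamma (M : Model T E) (u : T) : Measure (SubtreeSpace E u) := by
  classical
  exact if h : IsMax u then (M.K u (leafPoint h)).map fun y => join u (leafPoint h, y)
    else (M.aux u ⊗ₘ M.K u).map (join u)

/-- The product `γ_{𝒞_u}` of the measures `γ_v` over the children `v` of `u`. -/
def gammaC (M : Model T E) (u : T) : Measure (BelowSpace E u) :=
  (Measure.pi fun v : Children u => M.gamma v.1).map (glue u)

/-- The normalizing constant `Z_u`. -/
def Z (M : Model T E) (u : T) : ℝ := (M.ρ u).real Set.univ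

/-- The normalized target `μ_u`. -/
def μ (M : Model T E) (u : T) : Measure (SubtreeSpace E u) := normalized (M.ρ u)

/-- For all `u`, and all `v` that are not leaves, `ρ_u` is absolutely continuous with respect to
`γ_u` with derivative `w_u`, `γ_{v_-}` is absolutely continuous with respect to `γ_{𝒞_v}` with
derivative `w_{v_-}`, and these derivatives are positive everywhere. -/
structure AbsCont (M : Model T E) : Prop where
  ρ_eq : ∀ u, M.ρ u = reweigh (M.w u) (M.gamma u)
  aux_eq : ∀ v, ¬ IsMax v → M.aux v = reweigh (M.wAux v) (M.gammaC v)
  w_pos : ∀ u x, 0 < M.w u x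
  wAux_pos : ∀ v, ¬ IsMax v → ∀ x, 0 < M.wAux v x

/-- The weight functions are bounded. -/
structure BddWeights (M : Model T E) : Prop where
  w_bdd : ∀ u, BddAbove (Set.range fun x => |M.w u x|)
  wAux_bdd : ∀ v, ¬ IsMax v → BddAbove (Set.range fun x => |M.wAux v x|)

/-! ### The algorithm -/

/-- The product `γ_{𝒞_u}^N` of the measures `γ_v^N` returned by the calls at the children. -/
def gammaCN {N : ℕ} {u : T} (o : ∀ v : Children u, Output E N v.1) : Measure (BelowSpace E u) :=
  (Measure.pi fun v => gammaN (o v)).map (glue u)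

/-- Correction step: `γ_{u_-}^N = w_{u_-} γ_{𝒞_u}^N`. -/
def auxN (M : Model T E) {N : ℕ} {u : T} (o : ∀ v : Children u, Output E N v.1) :
    Measure (BelowSpace E u) :=
  reweigh (M.wAux u) (gammaCN o)

/-- Resampling and mutation steps: conditionally on the outputs `o` of the calls at the children,
draw `x 1, …, x N` independently from `π_{u_-}^N = γ_{u_-}^N / γ_{u_-}^N(1)`, then draw each
`y n` independently from `K_u (x n)`; the particles are the pairs `(x n, y n)`. This is the
law of the `N` particles. -/
def particles (M : Model T E) {N : ℕ} {u : T} (o : ∀ v : Children u, Output E N v.1) :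
    Measure (Fin N → SubtreeSpace E u) :=
  (Measure.pi fun _ : Fin N => normalized (M.auxN o)).bind fun x =>
    (Measure.pi fun n => M.K u (x n)).map fun y n => join u (x n, y n)

/-- The law of the output of the call at a node `u`, conditionally on the outputs `o` of the
calls at its children: the mass is `𝒵_u^N = γ_{u_-}^N(1)`. -/
def step (M : Model T E) {N : ℕ} {u : T} (o : ∀ v : Children u, Output E N v.1) :
    Measure (Output E N u) :=
  (M.particles o).map fun X => ((M.auxN o Set.univ).toNNReal, X)

/-- The law of the output of the algorithm called at `u` with `N` particles. At a leaf, the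
particles are drawn independently from `K_u` and the mass is `1`. At any other node, the algorithm
calls itself independently on all children and processes what they return. -/
def run (M : Model T E) (N : ℕ) (u : T) : Measure (Output E N u) := by
  classical
  exact if IsMax u then (Measure.pi fun _ : Fin N => M.gamma u).map fun X => (1, X)
    else (Measure.pi fun v : Children u => run M N v.1).bind fun o => M.step o
termination_by (wellFounded_gt (α := T)).wrap u
decreasing_by exact v.2.lt

/-- The estimator `ρ_u^N = w_u γ_u^N` of `ρ_u`. -/
def ρN (M : Model T E) {N : ℕ} {u : T} (o : Output E N u) : Measure (SubtreeSpace E u) :=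
  reweigh (M.w u) (gammaN o)

/-- The estimator `Z_u^N = ρ_u^N(1)` of `Z_u`. -/
def ZN (M : Model T E) {N : ℕ} {u : T} (o : Output E N u) : ℝ := (M.ρN o).real Set.univ

/-- The estimator `μ_u^N = ρ_u^N / Z_u^N` of `μ_u`. -/
def μN (M : Model T E) {N : ℕ} {u : T} (o : Output E N u) : Measure (SubtreeSpace E u) :=
  normalized (M.ρN o)

end Model

/-! ### Well-definedness

The maps used in the algorithm are measurable, and a run of the algorithm has a probability measure
as its law. -/

section WellDefined

lemma measurable_measurePi {A ι : Type*} [Fintype ι] {X : ι → Type*} [MeasurableSpace A] [∀ i, MeasurableSpace (X i)]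
    (κ : ∀ i, A → Measure (X i)) (h : ∀ i, Measurable (κ i)) [∀ i a, IsFiniteMeasure (κ i a)] :
    Measurable fun a => Measure.pi fun i => κ i a := by
  refine Measurable.measure_of_isPiSystem generateFrom_pi.symm isPiSystem_pi ?_ ?_
  · rintro _ ⟨s, hs, rfl⟩
    simp only [Measure.pi_pi]
    exact Finset.measurable_prod _ fun i _ => (Measure.measurable_coe (hs i (Set.mem_univ i))).comp (h i)
  · simp only [Measure.pi_univ]
    exact Finset.measurable_prod _ fun i _ => (Measure.measurable_coe MeasurableSet.univ).comp (h i)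

variable {T : RootedTree} {E : T → Type*} [∀ u, MeasurableSpace (E u)]

lemma measurable_glue [Finite T] (u : T) : Measurable (glue (E := E) u) := by
  refine measurable_pi_lambda _ fun w => ?_
  exact (measurable_pi_apply _).comp (measurable_pi_apply _)

lemma measurable_join (u : T) : Measurable (join (E := E) u) := by
  refine measurable_pi_lambda _ fun w => ?_
  obtain ⟨w, hw⟩ := w
  by_cases h : u = w
  · subst h
    simp only [join, dif_pos]
    exact measurable_snd
  · simp only [join, h, dif_neg, not_false_eq_true]
    exact (measurable_pi_apply _).comp measurable_fst

lemma measurable_gammaN {N : ℕ} {u : T} : Measurable (gammaN (E := E) (N := N) (u := u)) := by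
  refine Measure.measurable_of_measurable_coe _ fun s hs => ?_
  simp only [gammaN, Measure.smul_apply, Measure.finsetSum_apply, smul_eq_mul]
  have : ∀ n : Fin N, Measurable fun o : Output E N u => Measure.dirac (o.2 n) s := fun n =>
    (Measure.measurable_coe hs).comp (Measure.measurable_dirac.comp ((measurable_pi_apply n).comp measurable_snd))
  have h1 : Measurable fun o : Output E N u => ((o.1 : ℝ≥0∞) / N) :=
    (measurable_fst.coe_nnreal_ennreal).div_const _
  exact h1.mul (Finset.measurable_sum _ fun n _ => this n)

lemma gammaN_univ {N : ℕ} (hN : 0 < N) {u : T} (o : Output E N u) : gammaN o Set.univ = o.1 := by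
  simp only [gammaN, Measure.smul_apply, Measure.finsetSum_apply, measure_univ, smul_eq_mul]
  simp
  rw [ENNReal.div_mul_cancel] <;> simp [hN.ne']

instance {N : ℕ} {u : T} (o : Output E N u) : IsFiniteMeasure (gammaN o) := by
  rcases Nat.eq_zero_or_pos N with rfl | h
  · constructor; simp [gammaN]
  · exact ⟨by rw [gammaN_univ h]; simp⟩

lemma measurable_normalize {A X : Type*} [MeasurableSpace A] [MeasurableSpace X] {κ : A → Measure X}
   (h : Measurable κ) : Measurable fun a => normalized (κ a) := by
  refine Measure.measurable_of_measurable_coe _ fun s hs => ?_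
  simp only [normalized, Measure.smul_apply, smul_eq_mul]
  exact ((Measure.measurable_coe MeasurableSet.univ).comp h).inv.mul ((Measure.measurable_coe hs).comp h)

instance {X : Type*} [MeasurableSpace X] (μ : Measure X) : IsFiniteMeasure (normalized μ) := by
  constructor
  simp only [normalized, Measure.smul_apply, smul_eq_mul]
  exact lt_of_le_of_lt (ENNReal.inv_mul_le_one _) ENNReal.one_lt_top

lemma measurable_reweigh {A X : Type*} [MeasurableSpace A] [MeasurableSpace X] {κ : A → Measure X}
   (h : Measurable κ) {w : X → ℝ} (hw : Measurable w) : Measurable fun a => reweigh w (κ a) := by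
  refine Measure.measurable_of_measurable_coe _ fun s hs => ?_
  simp only [reweigh, withDensity_apply _ hs]
  simp only [← lintegral_indicator hs]
  exact (Measure.measurable_lintegral (hw.ennreal_ofReal.indicator hs)).comp h

variable [Finite T] (M : Model T E)

lemma measurable_gammaCN {N : ℕ} {u : T} : Measurable (Model.gammaCN (E := E) (N := N) (u := u)) :=
  (Measure.measurable_map _ (measurable_glue u)).comp
    (measurable_measurePi (fun v (o : ∀ v : Children u, Output E N v.1) => gammaN (o v))
      fun v => measurable_gammaN.comp (measurable_pi_apply v))

lemma measurable_auxN {N : ℕ} {u : T} : Measurable (M.auxN (N := N) (u := u)) :=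
  measurable_reweigh measurable_gammaCN (M.measurable_wAux u)

lemma measurable_mut {N : ℕ} {u : T} : Measurable fun x : Fin N → BelowSpace E u =>
    (Measure.pi fun n => M.K u (x n)).map fun y n => join u (x n, y n) := by
  have := M.markov_K u
  have h1 : Measurable fun x : Fin N → BelowSpace E u => Measure.pi fun n => M.K u (x n) :=
    measurable_measurePi (fun n (x : Fin N → BelowSpace E u) => M.K u (x n)) fun n => (M.K u).measurable.comp (measurable_pi_apply n)
  let κ : Kernel (Fin N → BelowSpace E u) (Fin N → E u) := ⟨_, h1⟩
  have : IsMarkovKernel κ := ⟨fun x => by change IsProbabilityMeasure (Measure.pi _); infer_instance⟩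
  let f : (Fin N → BelowSpace E u) × (Fin N → E u) → (Fin N → SubtreeSpace E u) := fun p n => join u (p.1 n, p.2 n)
  have hf : Measurable f := measurable_pi_lambda _ fun n => (measurable_join u).comp
    (((measurable_pi_apply n).comp measurable_fst).prodMk ((measurable_pi_apply n).comp measurable_snd))
  convert ((Kernel.id ×ₖ κ).map f).measurable using 2 with x
  rw [Kernel.map_apply _ hf, Kernel.prod_apply, Kernel.id_apply, Measure.dirac_prod, Measure.map_map hf (by fun_prop)]
  rfl

lemma measurable_particles {N : ℕ} {u : T} : Measurable (M.particles (N := N) (u := u)) := by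
  refine (Measure.measurable_bind' (measurable_mut M)).comp ?_
  exact measurable_measurePi (fun _ o => normalized (M.auxN o)) fun _ => measurable_normalize (measurable_auxN M)

lemma isProb_mut {N : ℕ} {u : T} (x : Fin N → BelowSpace E u) : IsProbabilityMeasure (
    (Measure.pi fun n => M.K u (x n)).map fun y n => join u (x n, y n)) := by
  have := M.markov_K u
  refine Measure.isProbabilityMeasure_map (Measurable.aemeasurable ?_)
  exact measurable_pi_lambda _ fun n => (measurable_join u).comp (measurable_const.prodMk (measurable_pi_apply n))

lemma isProb_bind {A B : Type*} [MeasurableSpace A] [MeasurableSpace B] (μ : Measure A) [IsProbabilityMeasure μ]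
   (f : A → Measure B) (hf : Measurable f) (h : ∀ᵐ a ∂μ, IsProbabilityMeasure (f a)) : IsProbabilityMeasure (μ.bind f) := by
  constructor
  rw [Measure.bind_apply MeasurableSet.univ hf.aemeasurable]
  rw [lintegral_congr_ae (g := fun _ => 1) (h.mono fun a ha => ha.measure_univ)]
  simp

lemma normalized_univ_le {X : Type*} [MeasurableSpace X] (μ : Measure X) : normalized μ Set.univ ≤ 1 := by
  simp only [normalized, Measure.smul_apply, smul_eq_mul]
  exact ENNReal.inv_mul_le_one _

lemma particles_univ_le {N : ℕ} {u : T} (o : ∀ v : Children u, Output E N v.1) : M.particles o Set.univ ≤ 1 := by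
  rw [Model.particles, Measure.bind_apply MeasurableSet.univ (measurable_mut M).aemeasurable]
  have : ∀ x : Fin N → BelowSpace E u, ((Measure.pi fun n => M.K u (x n)).map fun y n => join u (x n, y n)) Set.univ = 1 :=
    fun x => (isProb_mut M x).measure_univ
  simp only [this]
  rw [lintegral_one, Measure.pi_univ]
  exact Finset.prod_le_one' fun _ _ => normalized_univ_le _

lemma measurable_step {N : ℕ} {u : T} : Measurable (M.step (N := N) (u := u)) := by
  let κ : Kernel (∀ v : Children u, Output E N v.1) (Fin N → SubtreeSpace E u) := ⟨_, measurable_particles M⟩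
  let d : Kernel (∀ v : Children u, Output E N v.1) ℝ≥0 := Kernel.deterministic (fun o => (M.auxN o Set.univ).toNNReal)
    (((Measure.measurable_coe MeasurableSet.univ).comp (measurable_auxN M)).ennreal_toNNReal)
  have : IsSFiniteKernel κ := by
    have : IsFiniteKernel κ := ⟨1, ENNReal.one_lt_top, fun o => particles_univ_le M o⟩
    infer_instance
  convert (d ×ₖ κ).measurable using 1
  ext1 o
  rw [Kernel.prod_apply, Kernel.deterministic_apply, Measure.dirac_prod]
  rfl


lemma isProb_gamma_leaf {u : T} (hu : IsMax u) : IsProbabilityMeasure (M.gamma u) := by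
  have := M.markov_K u
  rw [Model.gamma, dif_pos hu]
  exact Measure.isProbabilityMeasure_map ((measurable_join u).comp (measurable_const.prodMk measurable_id)).aemeasurable

/-- Under the two assumptions, the output of the algorithm is a random element: its law is
a probability measure. Moreover, the mass `𝒵_u^N` is almost surely positive. -/
theorem isProbabilityMeasure_run (h1 : M.AbsCont) (h2 : M.BddWeights) {N : ℕ} (hN : 0 < N) (u : T) :
   IsProbabilityMeasure (M.run N u) ∧ ∀ᵐ o ∂(M.run N u), 0 < o.1 := by
  induction u using (wellFounded_gt (α := T)).induction with
  | _ u ih =>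
  by_cases hu : IsMax u
  · have := isProb_gamma_leaf M hu
    rw [Model.run, if_pos hu]
    have hm : Measurable fun X : Fin N → SubtreeSpace E u => ((1 : ℝ≥0), X) := by fun_prop
    refine ⟨Measure.isProbabilityMeasure_map hm.aemeasurable, ?_⟩
    rw [ae_map_iff hm.aemeasurable (measurableSet_lt measurable_const measurable_fst)]
    simp
  · rw [Model.run, if_neg hu]
    have hp : ∀ v : Children u, IsProbabilityMeasure (M.run N v.1) := fun v => (ih v.1 v.2.lt).1
    have hpos : ∀ᵐ o ∂(Measure.pi fun v : Children u => M.run N v.1), ∀ v, 0 < (o v).1 := by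
      rw [ae_all_iff]
      intro v
      exact (measurePreserving_eval (fun v : Children u => M.run N v.1) v).quasiMeasurePreserving.ae (ih v.1 v.2.lt).2
    obtain ⟨C, hC⟩ := h2.wAux_bdd u hu
    have key : ∀ o : (∀ v : Children u, Output E N v.1), (∀ v, 0 < (o v).1) →
        M.auxN o Set.univ ≠ 0 ∧ M.auxN o Set.univ ≠ ∞ := by
      intro o ho
      have hg : Model.gammaCN o Set.univ = ∏ v, ((o v).1 : ℝ≥0∞) := by
        rw [Model.gammaCN, Measure.map_apply (measurable_glue u) MeasurableSet.univ, Set.preimage_univ, Measure.pi_univ]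
        simp [gammaN_univ hN]
      constructor
      · intro h0
        rw [Model.auxN, reweigh, withDensity_apply _ MeasurableSet.univ, setLIntegral_univ,
          lintegral_eq_zero_iff (M.measurable_wAux u).ennreal_ofReal] at h0
        have : Model.gammaCN o = 0 := by
          rw [← ae_eq_bot, ← Filter.eventually_false_iff_eq_bot]
          filter_upwards [h0] with x hx
          simp at hx
          exact absurd (h1.wAux_pos u hu x) (not_lt.2 hx)
        rw [this] at hg
        simp only [Measure.coe_zero, Pi.zero_apply] at hg
        rw [eq_comm, Finset.prod_eq_zero_iff] at hg
        obtain ⟨v, -, hv⟩ := hg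
        have := ho v
        simp only [ENNReal.coe_eq_zero] at hv
        exact this.ne' hv
      · rw [Model.auxN, reweigh, withDensity_apply _ MeasurableSet.univ, setLIntegral_univ]
        refine ne_of_lt (lt_of_le_of_lt (lintegral_mono (g := fun _ => ENNReal.ofReal C) fun x => ?_) ?_)
        · exact ENNReal.ofReal_le_ofReal ((le_abs_self _).trans (hC ⟨x, rfl⟩))
        · rw [lintegral_const, hg]
          exact ENNReal.mul_lt_top ENNReal.ofReal_lt_top (ENNReal.prod_lt_top fun v _ => ENNReal.coe_lt_top)
    have hstep : ∀ o : (∀ v : Children u, Output E N v.1), (∀ v, 0 < (o v).1) →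
        IsProbabilityMeasure (M.step o) := by
      intro o ho
      have hn : IsProbabilityMeasure (normalized (M.auxN o)) := ⟨by
        simp only [normalized, Measure.smul_apply, smul_eq_mul]
        exact ENNReal.inv_mul_cancel (key o ho).1 (key o ho).2⟩
      have : IsProbabilityMeasure (M.particles o) :=
        isProb_bind _ _ (measurable_mut M) (Filter.Eventually.of_forall fun x => isProb_mut M x)
      exact Measure.isProbabilityMeasure_map (by fun_prop)
    refine ⟨isProb_bind _ _ (measurable_step M) (hpos.mono hstep), ?_⟩
    have hS : MeasurableSet {o : Output E N u | ¬ 0 < o.1} :=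
      (measurableSet_lt measurable_const measurable_fst).compl
    rw [ae_iff, Measure.bind_apply hS (measurable_step M).aemeasurable,
      lintegral_eq_zero_iff (show Measurable fun a => M.step a _ from
        (Measure.measurable_coe hS).comp (measurable_step M))]
    filter_upwards [hpos] with o ho
    rw [Model.step, Measure.map_apply (by fun_prop) hS]
    have : 0 < (M.auxN o Set.univ).toNNReal := ENNReal.toNNReal_pos (key o ho).1 (key o ho).2
    simp [this.ne']

end WellDefined

/-- The assertion `(𝔼 |f|^p)^(1/p) ≤ c`, including that `|f|^p` is integrable. -/
def LpBound {Ω : Type*} [MeasurableSpace Ω] (P : Measure Ω) (p : ℝ) (f : Ω → ℝ) (c : ℝ) : Prop :=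
  Integrable (fun ω => |f ω| ^ p) P ∧ (∫ ω, |f ω| ^ p ∂P) ^ (1 / p) ≤ c

end DaC

end

/-!
The argument is an induction from the leaves to the root for the unweighted measures `γ_u^N`
(`exists_momentBound_gamma`). Three facts carry it.

* Given the outputs of the calls at the children, the particles at `u` are independent
  (`particles_eq_pi`), so `γ_u^N(φ)` is a mass times an average of bounded independent random
  variables. Hoeffding's lemma bounds the `p`-th moment of its deviation from its conditional mean
  by a multiple of `N^(-p/2)` (`lintegral_rpow_abs_average_sub_le`, `lintegral_step_le`). The mass
  is bounded uniformly in `N` since the weights are (`exists_ae_mass_le`).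
* This conditional mean is the integral of a bounded function, `M.pullback u φ`, with respect to
  the product of the measures `γ_v^N` over the children `v`, and `γ_u(φ)` is the integral of the same
  function with respect to the product of the measures `γ_v` (`integral_propagate`).
* These two products are compared by exchanging one factor at a time (`MomentBound.pi`). Because
  the calls at the children are independent, the error made by exchanging the factor of `v` is the
  error of `γ_v^N` at a test function that is independent of `γ_v^N`, namely the original one with the
  other variables integrated out, and the induction hypothesis applies.

The inequality for `ρ_u^N` is the one for `γ_u^N` at the test function `w_u φ`. The one for `μ_u^N`
follows from `|μ_u^N(φ) - μ_u(φ)| ≤ (|ρ_u^N(φ) - ρ_u(φ)| + ‖φ‖ |Z_u^N - Z_u|) / Z_u`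
(`abs_μN_sub_le`), where `Z_u > 0` because all weights are positive.

The moments are lower Lebesgue integrals of `‖·‖ₑ ^ p` up to the last step, so integrability is
a consequence of the bounds.
-/

open MeasureTheory ProbabilityTheory
open scoped NNReal ENNReal

noncomputable section

namespace DaC

/-! ### Moments of bounded independent averages -/

/-- The average of `N` independent random variables with values in `[-1, 1]` deviates from their
common mean by `O(N^(-1/2))` in `L^p`. By Hoeffding's lemma the centred sum `S` is sub-Gaussian with
variance proxy `N`, and `|S|^p ≤ (p √N)^p (exp (S / √N) + exp (-S / √N))`. -/
theorem lintegral_rpow_abs_average_sub_le {X : Type*} [MeasurableSpace X] (m : Measure X)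
    [IsProbabilityMeasure m] {φ : X → ℝ} (hφ : Measurable φ) (h1 : ∀ x, |φ x| ≤ 1) {p : ℝ}
    (hp : 0 ≤ p) {N : ℕ} (hN : 0 < N) :
    ∫⁻ x, ‖(N : ℝ)⁻¹ * ∑ n, φ (x n) - ∫ y, φ y ∂m‖ₑ ^ p ∂(Measure.pi fun _ : Fin N => m)
      ≤ ENNReal.ofReal (p ^ p * (2 * Real.exp (1 / 2)) * (1 / √N) ^ p) := by
  have hN' : (0 : ℝ) < N := by exact_mod_cast hN
  have hs : 0 < √(N : ℝ) := Real.sqrt_pos.2 hN'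
  set P : Measure (Fin N → X) := Measure.pi fun _ => m
  set c : ℝ := ∫ y, φ y ∂m
  let S : (Fin N → X) → ℝ := fun x => ∑ n, (φ (x n) - c)
  have hS : HasSubgaussianMGF S N P := by
    have hind : iIndepFun (fun (n : Fin N) (x : Fin N → X) => φ (x n) - c) P :=
      iIndepFun_pi (X := fun _ y => φ y - c) fun _ => (hφ.sub_const c).aemeasurable
    have hsub : ∀ n : Fin N, HasSubgaussianMGF (fun x : Fin N → X => φ (x n) - c) 1 P := by
      intro n
      have hev := measurePreserving_eval (fun _ : Fin N => m) n
      have h := hasSubgaussianMGF_of_mem_Icc (μ := P) (X := fun x => φ (x n)) (a := -1) (b := 1)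
        (hφ.comp (measurable_pi_apply n)).aemeasurable
        (ae_of_all _ fun x => abs_le.1 (h1 (x n)))
      have hc : ∫ x, φ (x n) ∂P = c := by
        simp only [c]
        rw [← hev.map_eq, integral_map (measurable_pi_apply n).aemeasurable
          hφ.aestronglyMeasurable]
      rw [hc] at h
      convert h using 1
      ext; norm_num
    have h := HasSubgaussianMGF.sum_of_iIndepFun hind (s := Finset.univ) fun n _ => hsub n
    rwa [Finset.sum_const, Finset.card_univ, Fintype.card_fin, nsmul_one] at h
  -- for this `t`, the bound `exp (N t² / 2)` on the moment generating function does not depend on `N`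
  set t : ℝ := 1 / √N
  have ht : 0 < t := by positivity
  have hmgf : ∀ r : ℝ, r ^ 2 = t ^ 2 →
      ∫⁻ x, ENNReal.ofReal (Real.exp (r * S x)) ∂P ≤ ENNReal.ofReal (Real.exp (1 / 2)) := by
    intro r hr
    rw [← ofReal_integral_eq_lintegral_ofReal (hS.integrable_exp_mul r)
      (ae_of_all _ fun x => (Real.exp_pos _).le)]
    refine ENNReal.ofReal_le_ofReal ((hS.mgf_le r).trans (Real.exp_le_exp.2 (le_of_eq ?_)))
    rw [hr]
    simp only [t, div_pow, one_pow, Real.sq_sqrt hN'.le, NNReal.coe_natCast]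
    field_simp
  have hpt : ∀ x, ‖(N : ℝ)⁻¹ * ∑ n, φ (x n) - c‖ₑ ^ p ≤ ENNReal.ofReal (p ^ p * t ^ p) *
      (ENNReal.ofReal (Real.exp (t * S x)) + ENNReal.ofReal (Real.exp (-t * S x))) := by
    intro x
    have hx : (N : ℝ)⁻¹ * ∑ n, φ (x n) - c = (N : ℝ)⁻¹ * S x := by
      simp only [S, Finset.sum_sub_distrib, Finset.sum_const, Finset.card_univ, Fintype.card_fin,
        nsmul_eq_mul]
      field_simp
    rw [hx, Real.enorm_eq_ofReal_abs, ENNReal.ofReal_rpow_of_nonneg (abs_nonneg _) hp,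
      ← ENNReal.ofReal_add (Real.exp_pos _).le (Real.exp_pos _).le,
      ← ENNReal.ofReal_mul (by positivity)]
    refine ENNReal.ofReal_le_ofReal ?_
    rw [abs_mul, Real.mul_rpow (abs_nonneg _) (abs_nonneg _), abs_of_pos (inv_pos.2 hN')]
    have h2 := rpow_abs_le_mul_max_exp (S x) hp ht.ne'
    have h3 : (N : ℝ)⁻¹ ^ p * (p / |t|) ^ p = p ^ p * t ^ p := by
      rw [← Real.mul_rpow (by positivity) (by positivity), ← Real.mul_rpow hp ht.le, abs_of_pos ht]
      congr 1
      have : (N : ℝ) = √N * √N := (Real.mul_self_sqrt hN'.le).symm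
      rw [this]; simp only [t]; field_simp
    calc (N : ℝ)⁻¹ ^ p * |S x| ^ p ≤ (N : ℝ)⁻¹ ^ p * ((p / |t|) ^ p *
          max (Real.exp (t * S x)) (Real.exp (-t * S x))) := by gcongr
      _ = p ^ p * t ^ p * max (Real.exp (t * S x)) (Real.exp (-t * S x)) := by
          rw [← mul_assoc, h3]
      _ ≤ _ := by
          gcongr
          exact max_le_add_of_nonneg (Real.exp_pos _).le (Real.exp_pos _).le
  have hSm : Measurable S :=
    Finset.measurable_sum _ fun n _ => (hφ.comp (measurable_pi_apply n)).sub_const c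
  calc _ ≤ ∫⁻ x, ENNReal.ofReal (p ^ p * t ^ p) *
      (ENNReal.ofReal (Real.exp (t * S x)) + ENNReal.ofReal (Real.exp (-t * S x))) ∂P :=
        lintegral_mono hpt
    _ = ENNReal.ofReal (p ^ p * t ^ p) * (∫⁻ x, ENNReal.ofReal (Real.exp (t * S x)) ∂P +
          ∫⁻ x, ENNReal.ofReal (Real.exp (-t * S x)) ∂P) := by
        rw [lintegral_const_mul' _ _ ENNReal.ofReal_ne_top, lintegral_add_left (by fun_prop)]
    _ ≤ ENNReal.ofReal (p ^ p * t ^ p) *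
          (ENNReal.ofReal (Real.exp (1 / 2)) + ENNReal.ofReal (Real.exp (1 / 2))) := by
        gcongr
        · exact hmgf t rfl
        · exact hmgf (-t) (neg_sq t)
    _ = _ := by
        rw [← ENNReal.ofReal_add (Real.exp_pos _).le (Real.exp_pos _).le,
          ← ENNReal.ofReal_mul (by positivity)]
        congr 1; ring

/-! ### Replacing one factor of a product measure -/

section Update

variable {ι : Type*} [Fintype ι] [DecidableEq ι] {X : ι → Type*} [∀ i, MeasurableSpace (X i)]

/-- Resampling the `j`-th coordinate of a product measure, whose `j`-th factor is a probability
measure, replaces that factor. -/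
theorem map_update_prod_pi (η : ∀ i, Measure (X i)) [∀ i, IsFiniteMeasure (η i)] (j : ι)
    (κ : Measure (X j)) [IsFiniteMeasure κ] (hj : η j Set.univ = 1) :
    ((Measure.pi η).prod κ).map (fun q => Function.update q.1 j q.2) =
      Measure.pi (Function.update η j κ) := by
  have : ∀ i, IsFiniteMeasure (Function.update η j κ i) := by
    intro i
    by_cases h : i = j
    · subst h; simpa
    · simpa [h] using inferInstanceAs (IsFiniteMeasure (η i))
  symm
  refine Measure.pi_eq fun s hs => ?_
  have hm : Measurable fun q : (∀ i, X i) × X j => Function.update q.1 j q.2 :=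
    measurable_update'
  rw [Measure.map_apply hm (MeasurableSet.univ_pi hs)]
  have hset : (fun q : (∀ i, X i) × X j => Function.update q.1 j q.2) ⁻¹' Set.univ.pi s =
      (Set.univ.pi (Function.update s j Set.univ)) ×ˢ s j := by
    ext ⟨y, x⟩
    simp only [Set.mem_preimage, Set.mem_pi, Set.mem_univ, true_imp_iff, Set.mem_prod]
    constructor
    · intro h
      refine ⟨fun i => ?_, by simpa using h j⟩
      by_cases hi : i = j
      · subst hi; simp
      · simpa [hi] using h i
    · rintro ⟨h, hx⟩ i
      by_cases hi : i = j
      · subst hi; simpa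
      · simpa [hi] using h i
  rw [hset, Measure.prod_prod, Measure.pi_pi,
    ← Finset.mul_prod_erase _ _ (Finset.mem_univ j), ← Finset.mul_prod_erase _ _ (Finset.mem_univ j)]
  simp only [Function.update_self, hj, one_mul]
  rw [mul_comm]
  congr 1
  refine Finset.prod_congr rfl fun i hi => ?_
  simp [Finset.ne_of_mem_erase hi]

end Update

theorem lintegral_pi_prod {ι : Type*} [Fintype ι] {X : ι → Type*} [∀ i, MeasurableSpace (X i)]
    (m : ∀ i, Measure (X i)) [∀ i, IsProbabilityMeasure (m i)] {f : ∀ i, X i → ℝ≥0∞}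
    (hf : ∀ i, Measurable (f i)) :
    ∫⁻ x, ∏ i, f i (x i) ∂(Measure.pi m) = ∏ i, ∫⁻ y, f i y ∂(m i) := by
  have hind : iIndepFun (fun i (x : ∀ i, X i) => f i (x i)) (Measure.pi m) :=
    iIndepFun_pi fun i => (hf i).aemeasurable
  have h := lintegral_prod_eq_prod_lintegral_of_indepFun Finset.univ _ hind
    fun i => (hf i).comp (measurable_pi_apply i)
  rw [h]
  refine Finset.prod_congr rfl fun i _ => ?_
  exact (measurePreserving_eval m i).lintegral_comp (hf i)

/-! ### Moment bounds for random measures -/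

lemma integrable_of_abs_le {X : Type*} [MeasurableSpace X] {m : Measure X} [IsFiniteMeasure m]
    {φ : X → ℝ} (hφ : Measurable φ) {c : ℝ} (hc : ∀ x, |φ x| ≤ c) : Integrable φ m :=
  Integrable.of_bound hφ.aestronglyMeasurable c (ae_of_all _ hc)

lemma abs_integral_le {X : Type*} [MeasurableSpace X] {m : Measure X} [IsFiniteMeasure m]
    {φ : X → ℝ} {c : ℝ} (hc : ∀ x, |φ x| ≤ c) : |∫ x, φ x ∂m| ≤ c * m.real Set.univ :=
  norm_integral_le_of_norm_le_const (f := φ) (ae_of_all _ hc)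

lemma measurable_integral_measure {A X : Type*} [MeasurableSpace A] [MeasurableSpace X]
    {κ : A → Measure X} (hκ : Measurable κ) [∀ a, IsFiniteMeasure (κ a)] {φ : X → ℝ}
    (hφ : Measurable φ) {c : ℝ} (hc : ∀ x, |φ x| ≤ c) : Measurable fun a => ∫ x, φ x ∂(κ a) := by
  have h : ∀ a, ∫ x, φ x ∂(κ a) = (∫⁻ x, ENNReal.ofReal (φ x) ∂(κ a)).toReal -
      (∫⁻ x, ENNReal.ofReal (-φ x) ∂(κ a)).toReal := fun a =>
    integral_eq_lintegral_pos_part_sub_lintegral_neg_part (integrable_of_abs_le hφ hc)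
  simp only [h]
  exact ((Measure.measurable_lintegral hφ.ennreal_ofReal).comp hκ).ennreal_toReal.sub
    ((Measure.measurable_lintegral hφ.neg.ennreal_ofReal).comp hκ).ennreal_toReal

/-- The random measure `κ`, defined on a space with law `P`, is close to `ν` in the weak `L^p`
sense: `𝔼 |κ(φ) - ν(φ)|^p ≤ r` for every measurable `φ` with values in `[-1, 1]`. -/
def MomentBound {Ω X : Type*} [MeasurableSpace Ω] [MeasurableSpace X] (P : Measure Ω)
    (κ : Ω → Measure X) (ν : Measure X) (p : ℝ) (r : ℝ≥0∞) : Prop :=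
  ∀ φ : X → ℝ, Measurable φ → (∀ x, |φ x| ≤ 1) →
    ∫⁻ ω, ‖∫ x, φ x ∂(κ ω) - ∫ x, φ x ∂ν‖ₑ ^ p ∂P ≤ r

section MomentBound

variable {Ω X : Type*} [MeasurableSpace Ω] [MeasurableSpace X] {P : Measure Ω}
  {κ : Ω → Measure X} {ν : Measure X} {p : ℝ} {r r' : ℝ≥0∞}

lemma MomentBound.mono (h : MomentBound P κ ν p r) (hr : r ≤ r') : MomentBound P κ ν p r' :=
  fun φ hφ h1 => (h φ hφ h1).trans hr

lemma MomentBound.lintegral_le (h : MomentBound P κ ν p r) (hp : 0 < p) {φ : X → ℝ}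
    (hφ : Measurable φ) {c : ℝ} (hc : 0 ≤ c) (hφc : ∀ x, |φ x| ≤ c) :
    ∫⁻ ω, ‖∫ x, φ x ∂(κ ω) - ∫ x, φ x ∂ν‖ₑ ^ p ∂P ≤ ENNReal.ofReal c ^ p * r := by
  rcases hc.eq_or_lt with rfl | hc
  · have h0 : ∀ x, φ x = 0 := fun x => abs_nonpos_iff.1 (hφc x)
    simp [h0, hp]
  · have h1 := h (fun x => c⁻¹ * φ x) (hφ.const_mul _) fun x => by
      rw [abs_mul, abs_of_pos (inv_pos.2 hc)]
      exact (inv_mul_le_one₀ hc).2 (hφc x)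
    refine le_trans (le_of_eq ?_) (mul_le_mul_right h1 (ENNReal.ofReal c ^ p))
    rw [← lintegral_const_mul' _ _ (ENNReal.rpow_ne_top_of_nonneg hp.le ENNReal.ofReal_ne_top)]
    refine lintegral_congr fun ω => ?_
    rw [← ENNReal.mul_rpow_of_nonneg _ _ hp.le, integral_const_mul, integral_const_mul, ← mul_sub,
      enorm_mul, ← mul_assoc, Real.enorm_eq_ofReal (inv_pos.2 hc).le,
      ← ENNReal.ofReal_mul hc.le, mul_inv_cancel₀ hc.ne', ENNReal.ofReal_one, one_mul]

end MomentBound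

lemma enorm_sub_rpow_le {p : ℝ} (hp : 1 ≤ p) (a b c : ℝ) :
    ‖a - c‖ₑ ^ p ≤ 2 ^ (p - 1) * (‖a - b‖ₑ ^ p + ‖b - c‖ₑ ^ p) := by
  refine le_trans ?_ (ENNReal.rpow_add_le_mul_rpow_add_rpow _ _ hp)
  refine ENNReal.rpow_le_rpow ?_ (by linarith)
  rw [show a - c = (a - b) + (b - c) by ring]
  exact enorm_add_le _ _

lemma two_rpow_sub_one_mul_two (p : ℝ) : (2 : ℝ≥0∞) ^ (p - 1) * 2 = 2 ^ p := by
  conv_lhs => rw [← ENNReal.rpow_one 2, ← ENNReal.rpow_mul,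
    ← ENNReal.rpow_add _ _ (by simp) (by simp)]
  simp

/-! ### Products of independent random measures -/

lemma ae_pi_of_ae {ι : Type*} [Fintype ι] {Ω : ι → Type*} [∀ i, MeasurableSpace (Ω i)]
    {P : ∀ i, Measure (Ω i)} [∀ i, IsProbabilityMeasure (P i)] {q : ∀ i, Ω i → Prop}
    (h : ∀ i, ∀ᵐ ω ∂(P i), q i ω) : ∀ᵐ ω ∂(Measure.pi P), ∀ i, q i (ω i) := by
  rw [ae_all_iff]
  exact fun i => (measurePreserving_eval P i).quasiMeasurePreserving.ae (h i)

section Pi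

variable {ι : Type*} [Fintype ι] [DecidableEq ι] {X : ι → Type*} [∀ i, MeasurableSpace (X i)]

lemma integral_pi_update (η : ∀ i, Measure (X i)) [∀ i, IsFiniteMeasure (η i)] (j : ι)
    (κ : Measure (X j)) [IsFiniteMeasure κ] (hj : η j Set.univ = 1) {φ : (∀ i, X i) → ℝ}
    (hφ : Measurable φ) {c : ℝ} (hc : ∀ x, |φ x| ≤ c) :
    ∫ x, φ x ∂(Measure.pi (Function.update η j κ)) =
      ∫ t, ∫ y, φ (Function.update y j t) ∂(Measure.pi η) ∂κ := by
  rw [← map_update_prod_pi η j κ hj,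
    integral_map measurable_update'.aemeasurable hφ.aestronglyMeasurable, integral_prod_symm]
  exact integrable_of_abs_le (hφ.comp measurable_update') fun x => hc _

lemma lintegral_pi_eq_lintegral_update {Ω : ι → Type*} [∀ i, MeasurableSpace (Ω i)]
    (P : ∀ i, Measure (Ω i)) [∀ i, IsProbabilityMeasure (P i)] (j : ι) {f : (∀ i, Ω i) → ℝ≥0∞}
    (hf : Measurable f) :
    ∫⁻ ω, f ω ∂(Measure.pi P) =
      ∫⁻ ω, ∫⁻ t, f (Function.update ω j t) ∂(P j) ∂(Measure.pi P) := by
  conv_lhs => rw [← Function.update_eq_self j P]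
  rw [← map_update_prod_pi P j (P j) measure_univ, lintegral_map hf measurable_update',
    lintegral_prod]
  exact (hf.comp measurable_update').aemeasurable

/-- A product of independent random measures of bounded mass is close to the product of the
measures that they approximate. The factors are exchanged one at a time: integrating out the
other factors, exchanging the `j`-th one is an error of the `j`-th random measure at a test
function that is independent of it. -/
theorem MomentBound.pi {Ω : ι → Type*} [∀ i, MeasurableSpace (Ω i)] {P : ∀ i, Measure (Ω i)}
    [∀ i, IsProbabilityMeasure (P i)] {κ : ∀ i, Ω i → Measure (X i)}
    (hκ : ∀ i, Measurable (κ i)) [∀ i ω, IsFiniteMeasure (κ i ω)] {ν : ∀ i, Measure (X i)}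
    [∀ i, IsFiniteMeasure (ν i)] {B : ℝ≥0} (hB : 1 ≤ B) (hνB : ∀ i, ν i Set.univ ≤ B)
    (hκB : ∀ i, ∀ᵐ ω ∂(P i), κ i ω Set.univ ≤ B) {p : ℝ} (hp : 1 ≤ p) {r : ℝ≥0∞}
    (h : ∀ i, MomentBound (P i) (κ i) (ν i) p r) :
    MomentBound (Measure.pi P) (fun ω => Measure.pi fun i => κ i (ω i)) (Measure.pi ν) p
      ((2 ^ p) ^ Fintype.card ι * (((B : ℝ≥0∞) ^ Fintype.card ι) ^ p * r)) := by
  intro φ hφ h1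
  have hp0 : 0 < p := by linarith
  rcases isEmpty_or_nonempty (∀ i, X i) with hX | ⟨⟨x₀⟩⟩
  · simp [integral_of_isEmpty, hp0]
  set A : ℝ≥0∞ := ((B : ℝ≥0∞) ^ Fintype.card ι) ^ p * r
  -- the hybrid product, in which the factors indexed by `s` are random
  let H : Finset ι → (∀ i, Ω i) → ∀ i, Measure (X i) :=
    fun s ω i => if i ∈ s then κ i (ω i) else ν i
  have hHfin : ∀ s ω i, IsFiniteMeasure (H s ω i) := by
    intro s ω i
    by_cases hi : i ∈ s <;> simp only [H, hi, if_true, if_false] <;> infer_instance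
  let I : Finset ι → (∀ i, Ω i) → ℝ := fun s ω => ∫ x, φ x ∂(Measure.pi (H s ω))
  have hI : ∀ s, Measurable (I s) := by
    intro s
    have hm : Measurable fun ω => Measure.pi (H s ω) := by
      refine measurable_measurePi (fun i ω => H s ω i) fun i => ?_
      by_cases hi : i ∈ s
      · simp only [H, hi, if_true]; exact (hκ i).comp (measurable_pi_apply i)
      · simp only [H, hi, if_false]; exact measurable_const
    exact measurable_integral_measure hm hφ h1
  have hmass : ∀ᵐ ω ∂(Measure.pi P), ∀ i, κ i (ω i) Set.univ ≤ B :=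
    ae_pi_of_ae hκB
  have hstep : ∀ j s, j ∉ s →
      ∫⁻ ω, ‖I (insert j s) ω - I s ω‖ₑ ^ p ∂(Measure.pi P) ≤ A := by
    intro j s hjs
    have hmeas : Measurable fun ω => ‖I (insert j s) ω - I s ω‖ₑ ^ p :=
      ((hI _).sub (hI _)).enorm.pow_const p
    rw [lintegral_pi_eq_lintegral_update P j hmeas]
    have hle : ∀ᵐ ω ∂(Measure.pi P), ∫⁻ t, ‖I (insert j s) (Function.update ω j t) -
        I s (Function.update ω j t)‖ₑ ^ p ∂(P j) ≤ A := by
      filter_upwards [hmass] with ω hω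
      -- the `j`-th factor is integrated last, so any probability measure can stand in for it
      let η : ∀ i, Measure (X i) := Function.update (H s ω) j (Measure.dirac (x₀ j))
      have hη : ∀ i, η i Set.univ ≤ B := by
        intro i
        by_cases hi : i = j
        · subst hi; simpa [η] using hB
        · by_cases his : i ∈ s <;> simp only [η, H, his, if_true, if_false, ne_eq, hi,
            not_false_eq_true, Function.update_of_ne]
          exacts [hω i, hνB i]
      have hηfin : ∀ i, IsFiniteMeasure (η i) := fun i =>
        ⟨(hη i).trans_lt ENNReal.coe_lt_top⟩
      have hηj : η j Set.univ = 1 := by simp [η]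
      let Ψ : X j → ℝ := fun t => ∫ y, φ (Function.update y j t) ∂(Measure.pi η)
      have hΨm : Measurable Ψ := by
        have : StronglyMeasurable fun q : (∀ i, X i) × X j => φ (Function.update q.1 j q.2) :=
          (hφ.comp measurable_update').stronglyMeasurable
        exact this.integral_prod_left'.measurable
      have hΨB : ∀ t, |Ψ t| ≤ (B : ℝ) ^ Fintype.card ι := by
        intro t
        refine (abs_integral_le fun y => h1 _).trans ?_
        rw [one_mul, Measure.real, Measure.pi_univ, ← Finset.card_univ]
        have := ENNReal.toReal_mono (by finiteness)
          (Finset.prod_le_pow_card Finset.univ (fun i => η i Set.univ) (B : ℝ≥0∞) fun i _ => hη i)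
        simpa using this
      have hins : ∀ t, I (insert j s) (Function.update ω j t) = ∫ x, Ψ x ∂(κ j t) := by
        intro t
        rw [← integral_pi_update η j (κ j t) hηj hφ h1]
        simp only [I]
        congr 2
        ext1 i
        by_cases hi : i = j
        · subst hi; simp [H]
        · simp [H, η, hi]
      have hs : ∀ t, I s (Function.update ω j t) = ∫ x, Ψ x ∂(ν j) := by
        intro t
        rw [← integral_pi_update η j (ν j) hηj hφ h1]
        simp only [I]
        congr 2
        ext1 i
        by_cases hi : i = j
        · subst hi; simp [H, hjs]
        · simp [H, η, hi]
      simp only [hins, hs]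
      refine ((h j).lintegral_le hp0 hΨm (by positivity) hΨB).trans (le_of_eq ?_)
      simp only [A]
      rw [ENNReal.ofReal_pow B.coe_nonneg, ENNReal.ofReal_coe_nnreal]
    refine (lintegral_mono_ae hle).trans ?_
    simp
  have hall : ∀ s : Finset ι,
      ∫⁻ ω, ‖I s ω - I ∅ ω‖ₑ ^ p ∂(Measure.pi P) ≤ (2 ^ p) ^ s.card * A := by
    intro s
    induction s using Finset.induction_on with
    | empty => simp [hp0]
    | insert j s hjs ih =>
      have h2 : (1 : ℝ≥0∞) ≤ 2 ^ p := ENNReal.one_le_rpow (by norm_num) hp0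
      calc _ ≤ ∫⁻ ω, 2 ^ (p - 1) * (‖I (insert j s) ω - I s ω‖ₑ ^ p + ‖I s ω - I ∅ ω‖ₑ ^ p)
            ∂(Measure.pi P) := lintegral_mono fun ω => enorm_sub_rpow_le hp _ _ _
        _ = 2 ^ (p - 1) * (∫⁻ ω, ‖I (insert j s) ω - I s ω‖ₑ ^ p ∂(Measure.pi P) +
            ∫⁻ ω, ‖I s ω - I ∅ ω‖ₑ ^ p ∂(Measure.pi P)) := by
          rw [lintegral_const_mul' _ _ (ENNReal.rpow_ne_top_of_nonneg (by linarith) (by simp)),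
            lintegral_add_left (by fun_prop)]
        _ ≤ 2 ^ (p - 1) * ((2 ^ p) ^ s.card * A + (2 ^ p) ^ s.card * A) := by
          gcongr
          exact (hstep j s hjs).trans (le_mul_of_one_le_left' (one_le_pow₀ h2))
        _ = (2 ^ p) ^ (insert j s).card * A := by
          rw [Finset.card_insert_of_notMem hjs, ← two_mul, ← mul_assoc,
            two_rpow_sub_one_mul_two, pow_succ]
          ring
  have hfin := hall Finset.univ
  simpa [I, H] using hfin

end Pi

/-! ### One step of the algorithm -/

lemma exists_nonneg_forall_le {X : Type*} {w : X → ℝ}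
    (h : BddAbove (Set.range fun x => |w x|)) : ∃ W, 0 ≤ W ∧ ∀ x, |w x| ≤ W := by
  obtain ⟨W, hW⟩ := h
  exact ⟨max W 0, le_max_right _ _, fun x => (hW ⟨x, rfl⟩).trans (le_max_left _ _)⟩

section Reweigh

variable {X : Type*} [MeasurableSpace X]

lemma reweigh_univ_le {w : X → ℝ} {W : ℝ} (hW : ∀ x, |w x| ≤ W) (m : Measure X) :
    reweigh w m Set.univ ≤ ENNReal.ofReal W * m Set.univ := by
  rw [reweigh, withDensity_apply _ MeasurableSet.univ, setLIntegral_univ, ← lintegral_const]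
  exact lintegral_mono fun x => ENNReal.ofReal_le_ofReal ((le_abs_self _).trans (hW x))

lemma isFiniteMeasure_reweigh {w : X → ℝ} {W : ℝ} (hW : ∀ x, |w x| ≤ W) (m : Measure X)
    [IsFiniteMeasure m] : IsFiniteMeasure (reweigh w m) :=
  ⟨(reweigh_univ_le hW m).trans_lt (ENNReal.mul_lt_top ENNReal.ofReal_lt_top (measure_lt_top _ _))⟩

lemma integral_reweigh {w : X → ℝ} (hw : Measurable w) (h0 : ∀ x, 0 ≤ w x) (m : Measure X)
    (φ : X → ℝ) : ∫ x, φ x ∂(reweigh w m) = ∫ x, w x * φ x ∂m := by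
  rw [reweigh, integral_withDensity_eq_integral_toReal_smul hw.ennreal_ofReal
    (ae_of_all _ fun _ => ENNReal.ofReal_lt_top)]
  simp [ENNReal.toReal_ofReal (h0 _)]

lemma integral_normalized (m : Measure X) (φ : X → ℝ) :
    ∫ x, φ x ∂(normalized m) = (m.real Set.univ)⁻¹ * ∫ x, φ x ∂m := by
  rw [normalized, integral_smul_measure, ENNReal.toReal_inv, smul_eq_mul, Measure.real]

end Reweigh

lemma integral_gammaN {T : RootedTree} {E : T → Type*} [∀ u, MeasurableSpace (E u)] {N : ℕ} {u : T}
    (o : Output E N u) {φ : SubtreeSpace E u → ℝ} (hφ : Measurable φ) :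
    ∫ x, φ x ∂(gammaN o) = o.1 * ((N : ℝ)⁻¹ * ∑ n, φ (o.2 n)) := by
  rw [gammaN, integral_smul_measure, integral_finsetSum_measure fun n _ =>
    integrable_dirac' hφ.stronglyMeasurable (by simp)]
  simp only [integral_dirac' _ _ hφ.stronglyMeasurable, smul_eq_mul, ENNReal.toReal_div,
    ENNReal.coe_toReal, ENNReal.toReal_natCast]
  ring

/-- The constant of the moment bound for an average of independent random variables. -/
def momentConst (p : ℝ) : ℝ≥0 := Real.toNNReal (p ^ p * (2 * Real.exp (1 / 2)))

/-- The rate `N^(-p/2)`. -/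
def rate (p : ℝ) (N : ℕ) : ℝ≥0∞ := ENNReal.ofReal (1 / √N) ^ p

lemma lintegral_enorm_gammaN_sub_le {T : RootedTree} {E : T → Type*}
    [∀ u, MeasurableSpace (E u)] {N : ℕ} (hN : 0 < N) {u : T}
    (m : Measure (SubtreeSpace E u)) [IsProbabilityMeasure m] (z : ℝ≥0) {p : ℝ} (hp : 1 ≤ p)
    {φ : SubtreeSpace E u → ℝ} (hφ : Measurable φ) (h1 : ∀ x, |φ x| ≤ 1) :
    ∫⁻ X, ‖∫ x, φ x ∂(gammaN ((z, X) : Output E N u)) - z * ∫ x, φ x ∂m‖ₑ ^ p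
      ∂(Measure.pi fun _ : Fin N => m) ≤ (z : ℝ≥0∞) ^ p * (momentConst p * rate p N) := by
  have hp0 : 0 < p := by linarith
  have h := lintegral_rpow_abs_average_sub_le m hφ h1 hp0.le hN
  rw [ENNReal.ofReal_mul (by positivity), ← ENNReal.ofReal_rpow_of_nonneg (by positivity) hp0.le]
    at h
  refine le_trans (le_of_eq ?_) (mul_le_mul_right h ((z : ℝ≥0∞) ^ p))
  rw [← lintegral_const_mul' _ _ (ENNReal.rpow_ne_top_of_nonneg hp0.le ENNReal.coe_ne_top)]
  refine lintegral_congr fun X => ?_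
  rw [integral_gammaN _ hφ, ← mul_sub, enorm_mul, ENNReal.mul_rpow_of_nonneg _ _ hp0.le,
    Real.enorm_eq_ofReal z.coe_nonneg, ENNReal.ofReal_coe_nnreal]

section Model

variable {T : RootedTree} [Finite T] {E : T → Type*} [∀ u, MeasurableSpace (E u)] (M : Model T E)

instance isFiniteMeasure_gamma (u : T) : IsFiniteMeasure (M.gamma u) := by
  by_cases hu : IsMax u
  · have := isProb_gamma_leaf M hu
    infer_instance
  · have := M.finite_aux u
    have := M.markov_K u
    rw [Model.gamma, dif_neg hu]
    infer_instance

/-- The measure `(w_{u_-} m) ⊗ K_u` obtained from a measure `m` on the product of the sub-tree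
spaces of the children of `u`. Both `γ_u` and the conditional mean of `γ_u^N` are of this form. -/
def Model.propagate (u : T) (m : Measure (∀ v : Children u, SubtreeSpace E v.1)) :
    Measure (SubtreeSpace E u) :=
  ((reweigh (M.wAux u) (m.map (glue u))) ⊗ₘ M.K u).map (join u)

lemma gamma_eq_propagate (h1 : M.AbsCont) {u : T} (hu : ¬ IsMax u) :
    M.gamma u = M.propagate u (Measure.pi fun v : Children u => M.gamma v.1) := by
  rw [Model.gamma, dif_neg hu, h1.aux_eq u hu]
  rfl

/-- The test function on the product of the sub-tree spaces of the children of `u` whose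
`m`-integral is the integral of `φ` with respect to `M.propagate u m`. -/
def Model.pullback (u : T) (φ : SubtreeSpace E u → ℝ) (y : ∀ v : Children u, SubtreeSpace E v.1) :
    ℝ :=
  M.wAux u (glue u y) * ∫ z, φ (join u (glue u y, z)) ∂(M.K u (glue u y))

lemma measurable_kernel_integral (u : T) {φ : SubtreeSpace E u → ℝ} (hφ : Measurable φ) :
    Measurable fun x => ∫ z, φ (join u (x, z)) ∂(M.K u x) := by
  have := M.markov_K u
  have h : StronglyMeasurable fun q : BelowSpace E u × E u => φ (join u q) :=
    (hφ.comp (measurable_join u)).stronglyMeasurable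
  exact h.integral_kernel_prod_right'.measurable

lemma measurable_pullback (u : T) {φ : SubtreeSpace E u → ℝ} (hφ : Measurable φ) :
    Measurable (M.pullback u φ) :=
  ((M.measurable_wAux u).mul (measurable_kernel_integral M u hφ)).comp (measurable_glue u)

lemma abs_pullback_le {u : T} {W : ℝ} (hW : ∀ x, |M.wAux u x| ≤ W) {φ : SubtreeSpace E u → ℝ}
    (h1 : ∀ x, |φ x| ≤ 1) (y : ∀ v : Children u, SubtreeSpace E v.1) :
    |M.pullback u φ y| ≤ W := by
  have := M.markov_K u
  rw [Model.pullback, abs_mul]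
  refine (mul_le_mul (hW _) (abs_integral_le fun z => h1 _) (abs_nonneg _)
    ((abs_nonneg _).trans (hW (glue u y)))).trans (le_of_eq ?_)
  simp

lemma integral_propagate {u : T} {W : ℝ} (hW : ∀ x, |M.wAux u x| ≤ W)
    (h0 : ∀ x, 0 < M.wAux u x) (m : Measure (∀ v : Children u, SubtreeSpace E v.1))
    [IsFiniteMeasure m] {φ : SubtreeSpace E u → ℝ} (hφ : Measurable φ) (h1 : ∀ x, |φ x| ≤ 1) :
    ∫ x, φ x ∂(M.propagate u m) = ∫ y, M.pullback u φ y ∂m := by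
  have := M.markov_K u
  have := isFiniteMeasure_reweigh hW (m.map (glue u))
  have hint : Integrable (fun q => φ (join u q))
      (reweigh (M.wAux u) (m.map (glue u)) ⊗ₘ M.K u) :=
    integrable_of_abs_le (hφ.comp (measurable_join u)) fun q => h1 _
  rw [Model.propagate, integral_map (measurable_join u).aemeasurable hφ.aestronglyMeasurable,
    Measure.integral_compProd hint,
    integral_reweigh (M.measurable_wAux u) fun x => (h0 x).le]
  exact integral_map (measurable_glue u).aemeasurable
    ((M.measurable_wAux u).mul (measurable_kernel_integral M u hφ)).aestronglyMeasurable

/-- Conditionally on the outputs of the calls at the children, the particles are independent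
with law `π_{u_-}^N ⊗ K_u`. -/
lemma particles_eq_pi {N : ℕ} {u : T} (o : ∀ v : Children u, Output E N v.1)
    [IsProbabilityMeasure (normalized (M.auxN o))] :
    M.particles o = Measure.pi fun _ : Fin N =>
      ((normalized (M.auxN o)) ⊗ₘ M.K u).map (join u) := by
  have := M.markov_K u
  symm
  refine Measure.pi_eq fun s hs => ?_
  have hjoin : ∀ x : BelowSpace E u, Measurable fun z : E u => join u (x, z) := fun x =>
    (measurable_join u).comp measurable_prodMk_left
  have hm : ∀ n, Measurable fun x => M.K u x (Prod.mk x ⁻¹' (join u ⁻¹' s n)) := fun n =>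
    Kernel.measurable_kernel_prodMk_left (measurable_join u (hs n))
  have hmap : ∀ x : Fin N → BelowSpace E u,
      ((Measure.pi fun n => M.K u (x n)).map fun y n => join u (x n, y n)) (Set.univ.pi s) =
        ∏ n, M.K u (x n) (Prod.mk (x n) ⁻¹' (join u ⁻¹' s n)) := by
    intro x
    have hmx : Measurable fun (y : Fin N → E u) n => join u (x n, y n) :=
      measurable_pi_lambda _ fun n => (hjoin (x n)).comp (measurable_pi_apply n)
    rw [Measure.map_apply hmx (MeasurableSet.univ_pi hs), ← Measure.pi_pi]
    rfl
  rw [Model.particles, Measure.bind_apply (MeasurableSet.univ_pi hs)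
    (measurable_mut M).aemeasurable]
  simp only [hmap]
  rw [lintegral_pi_prod (fun _ : Fin N => normalized (M.auxN o)) hm]
  refine Finset.prod_congr rfl fun n _ => ?_
  rw [Measure.map_apply (measurable_join u) (hs n),
    Measure.compProd_apply (measurable_join u (hs n))]

instance isFiniteMeasure_gammaCN {N : ℕ} {u : T} (o : ∀ v : Children u, Output E N v.1) :
    IsFiniteMeasure (Model.gammaCN o) := by
  rw [Model.gammaCN]; infer_instance

/-- Resampling and mutation: conditionally on the outputs of the calls at the children, `γ_u^N` is
close to its conditional mean. If the total mass vanishes, then both are zero. -/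
lemma lintegral_step_le {N : ℕ} (hN : 0 < N) {u : T} {W : ℝ} (hW : ∀ x, |M.wAux u x| ≤ W)
    (o : ∀ v : Children u, Output E N v.1) {p : ℝ} (hp : 1 ≤ p)
    {φ : SubtreeSpace E u → ℝ} (hφ : Measurable φ) (h1 : ∀ x, |φ x| ≤ 1) :
    ∫⁻ o', ‖∫ x, φ x ∂(gammaN o') -
        ∫ x, φ x ∂(M.propagate u (Measure.pi fun v => gammaN (o v)))‖ₑ ^ p ∂(M.step o) ≤
      (M.auxN o Set.univ) ^ p * (momentConst p * rate p N) := by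
  have := M.markov_K u
  have hp0 : 0 < p := by linarith
  have hfin : IsFiniteMeasure (M.auxN o) := isFiniteMeasure_reweigh hW _
  have hprop : M.propagate u (Measure.pi fun v => gammaN (o v)) =
      (M.auxN o ⊗ₘ M.K u).map (join u) := rfl
  have hmeas : Measurable fun o' : Output E N u => ∫ x, φ x ∂(gammaN o') :=
    measurable_integral_measure measurable_gammaN hφ h1
  rw [Model.step, lintegral_map ((hmeas.sub_const _).enorm.pow_const p) (by fun_prop), hprop]
  rcases eq_or_ne (M.auxN o Set.univ) 0 with h0 | h0
  · rw [Measure.measure_univ_eq_zero] at h0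
    simp [h0, integral_gammaN _ hφ, hp0]
  · have hn : IsProbabilityMeasure (normalized (M.auxN o)) := ⟨by
      simp only [normalized, Measure.smul_apply, smul_eq_mul]
      exact ENNReal.inv_mul_cancel h0 (measure_ne_top _ _)⟩
    have hprob : IsProbabilityMeasure ((normalized (M.auxN o) ⊗ₘ M.K u).map (join u)) :=
      Measure.isProbabilityMeasure_map (measurable_join u).aemeasurable
    have hmean : ∫ x, φ x ∂((M.auxN o ⊗ₘ M.K u).map (join u)) =
        (M.auxN o Set.univ).toNNReal *
          ∫ x, φ x ∂((normalized (M.auxN o) ⊗ₘ M.K u).map (join u)) := by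
      rw [normalized, Measure.compProd_smul_left, Measure.map_smul, integral_smul_measure,
        ENNReal.toReal_inv, smul_eq_mul, ENNReal.coe_toNNReal_eq_toReal, mul_inv_cancel_left₀]
      exact ENNReal.toReal_ne_zero.2 ⟨h0, measure_ne_top _ _⟩
    rw [particles_eq_pi, hmean]
    refine (lintegral_enorm_gammaN_sub_le hN _ _ hp hφ h1).trans (le_of_eq ?_)
    rw [ENNReal.coe_toNNReal (measure_ne_top _ _)]

/-! ### The induction along the tree -/

lemma auxN_univ_le {N : ℕ} (hN : 0 < N) {u : T} {W : ℝ} (hW : ∀ x, |M.wAux u x| ≤ W) {B : ℝ≥0}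
    {o : ∀ v : Children u, Output E N v.1} (ho : ∀ v, (o v).1 ≤ B) :
    M.auxN o Set.univ ≤ ENNReal.ofReal W * B ^ Fintype.card (Children u) := by
  refine (reweigh_univ_le hW _).trans ?_
  gcongr
  rw [Model.gammaCN, Measure.map_apply (measurable_glue u) MeasurableSet.univ, Set.preimage_univ,
    Measure.pi_univ, ← Finset.card_univ]
  refine Finset.prod_le_pow_card _ _ _ fun v _ => ?_
  rw [gammaN_univ hN]
  exact_mod_cast ho v

/-- The mass `𝒵_u^N` is bounded uniformly in `N`, because it is at most a bound on `w_{u_-}` times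
the product of the masses returned by the calls at the children. -/
theorem exists_ae_mass_le (h1 : M.AbsCont) (h2 : M.BddWeights) (u : T) :
    ∃ B : ℝ≥0, ∀ N, 0 < N → ∀ᵐ o ∂(M.run N u), o.1 ≤ B := by
  induction u using (wellFounded_gt (α := T)).induction with
  | _ u ih =>
  by_cases hu : IsMax u
  · refine ⟨1, fun N hN => ?_⟩
    have := isProb_gamma_leaf M hu
    rw [Model.run, if_pos hu, ae_map_iff (by fun_prop)
      (measurableSet_le measurable_fst measurable_const)]
    simp
  · choose b hb using fun v : Children u => ih v.1 v.2.lt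
    obtain ⟨W, hW0, hW⟩ := exists_nonneg_forall_le (h2.wAux_bdd u hu)
    refine ⟨W.toNNReal * (∑ v, b v) ^ Fintype.card (Children u), fun N hN => ?_⟩
    have hP : ∀ v : Children u, IsProbabilityMeasure (M.run N v.1) := fun v =>
      (isProbabilityMeasure_run M h1 h2 hN v.1).1
    have hS : MeasurableSet {o : Output E N u |
        ¬ o.1 ≤ W.toNNReal * (∑ v, b v) ^ Fintype.card (Children u)} :=
      (measurableSet_le measurable_fst measurable_const).compl
    rw [Model.run, if_neg hu, ae_iff, Measure.bind_apply hS (measurable_step M).aemeasurable,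
      lintegral_eq_zero_iff (show Measurable fun a => M.step a _ from
        (Measure.measurable_coe hS).comp (measurable_step M))]
    filter_upwards [ae_pi_of_ae fun v => hb v N hN] with o ho
    rw [Model.step, Measure.map_apply (by fun_prop) hS]
    have hle := auxN_univ_le M hN hW (B := ∑ v, b v) fun v => (ho v).trans
      (Finset.single_le_sum (f := b) (fun _ _ => zero_le) (Finset.mem_univ v))
    have hle' : (M.auxN o Set.univ).toNNReal ≤
        W.toNNReal * (∑ v, b v) ^ Fintype.card (Children u) :=
      ENNReal.toNNReal_mono (by finiteness) hle |>.trans_eq (by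
        rw [ENNReal.toNNReal_mul, ENNReal.toNNReal_pow, ENNReal.toNNReal_coe]; rfl)
    simp [hle'.not_gt]

/-- The `L^p` inequality for the unweighted measures `γ_u^N`. At an inner node, the error splits into
the resampling error given the outputs of the children, and the error of the product of the
measures `γ_v^N` at the test function `M.pullback u φ`. -/
theorem exists_momentBound_gamma (h1 : M.AbsCont) (h2 : M.BddWeights) {p : ℝ} (hp : 1 ≤ p)
    (u : T) : ∃ C : ℝ≥0, ∀ N, 0 < N →
      MomentBound (M.run N u) (fun o => gammaN o) (M.gamma u) p (C * rate p N) := by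
  have hp0 : 0 < p := by linarith
  induction u using (wellFounded_gt (α := T)).induction with
  | _ u ih =>
  by_cases hu : IsMax u
  · refine ⟨momentConst p, fun N hN φ hφ hφ1 => ?_⟩
    have := isProb_gamma_leaf M hu
    have hmeas : Measurable fun o' : Output E N u => ∫ x, φ x ∂(gammaN o') :=
      measurable_integral_measure measurable_gammaN hφ hφ1
    rw [Model.run, if_pos hu, lintegral_map ((hmeas.sub_const _).enorm.pow_const p) (by fun_prop)]
    simpa using lintegral_enorm_gammaN_sub_le hN (M.gamma u) 1 hp hφ hφ1
  · choose c hc using fun v : Children u => ih v.1 v.2.lt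
    choose b hb using fun v : Children u => exists_ae_mass_le M h1 h2 v.1
    obtain ⟨W, hW0, hW⟩ := exists_nonneg_forall_le (h2.wAux_bdd u hu)
    have hw0 := h1.wAux_pos u hu
    classical
    let g : Children u → ℝ≥0 := fun v => (M.gamma v.1 Set.univ).toNNReal
    let B : ℝ≥0 := 1 + ∑ v, (b v + g v)
    have hbg : ∀ v, b v + g v ≤ B := fun v =>
      (Finset.single_le_sum (f := fun v => b v + g v) (fun _ _ => zero_le)
        (Finset.mem_univ v)).trans le_add_self
    let k := Fintype.card (Children u)
    -- the first term bounds the resampling error, the second one the error inherited from the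
    -- children
    let C : ℝ≥0∞ := 2 ^ (p - 1) * ((ENNReal.ofReal W * B ^ k) ^ p * momentConst p +
      ENNReal.ofReal W ^ p * ((2 ^ p) ^ k * (((B : ℝ≥0∞) ^ k) ^ p * ↑(∑ v, c v))))
    have hC : C ≠ ∞ := by
      have : (2 : ℝ≥0∞) ^ (p - 1) ≠ ∞ := ENNReal.rpow_ne_top_of_nonneg (by linarith) (by simp)
      simp only [C]
      finiteness
    refine ⟨C.toNNReal, fun N hN φ hφ hφ1 => ?_⟩
    rw [ENNReal.coe_toNNReal hC]
    have hP : ∀ v : Children u, IsProbabilityMeasure (M.run N v.1) := fun v =>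
      (isProbabilityMeasure_run M h1 h2 hN v.1).1
    have hmeas : Measurable fun o' : Output E N u => ∫ x, φ x ∂(gammaN o') :=
      measurable_integral_measure measurable_gammaN hφ hφ1
    have hgamma : ∫ x, φ x ∂(M.gamma u) =
        ∫ y, M.pullback u φ y ∂(Measure.pi fun v : Children u => M.gamma v.1) := by
      rw [gamma_eq_propagate M h1 hu, integral_propagate M hW hw0 _ hφ hφ1]
    have hpi := MomentBound.pi (ι := Children u) (P := fun v => M.run N v.1)
      (κ := fun v o => gammaN o) (fun v => measurable_gammaN) (ν := fun v => M.gamma v.1) (B := B)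
      le_self_add (fun v => by
        rw [← ENNReal.coe_toNNReal (measure_ne_top (M.gamma v.1) Set.univ)]
        exact_mod_cast le_add_self.trans (hbg v))
      (fun v => (hb v N hN).mono fun o ho => by
        rw [gammaN_univ hN]
        exact_mod_cast ho.trans (le_self_add.trans (hbg v))) hp
      (r := ↑(∑ v, c v) * rate p N)
      (fun v => (hc v N hN).mono (by
        gcongr
        exact Finset.single_le_sum (f := c) (fun _ _ => zero_le) (Finset.mem_univ v)))
    rw [Model.run, if_neg hu, Measure.lintegral_bind (measurable_step M).aemeasurable
      ((hmeas.sub_const _).enorm.pow_const p).aemeasurable]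
    let D : (∀ v : Children u, Output E N v.1) → ℝ := fun o =>
      ∫ y, M.pullback u φ y ∂(Measure.pi fun v => gammaN (o v)) - ∫ x, φ x ∂(M.gamma u)
    have hcond : ∀ᵐ o ∂(Measure.pi fun v : Children u => M.run N v.1),
        ∫⁻ o', ‖∫ x, φ x ∂(gammaN o') - ∫ x, φ x ∂(M.gamma u)‖ₑ ^ p ∂(M.step o) ≤
          2 ^ (p - 1) * ((ENNReal.ofReal W * B ^ k) ^ p * (momentConst p * rate p N) +
            ‖D o‖ₑ ^ p) := by
      filter_upwards [ae_pi_of_ae fun v => hb v N hN] with o ho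
      have haux : M.auxN o Set.univ ≤ ENNReal.ofReal W * B ^ k :=
        auxN_univ_le M hN hW fun v => (ho v).trans (le_self_add.trans (hbg v))
      have hstep := lintegral_step_le M hN hW o hp hφ hφ1
      rw [integral_propagate M hW hw0 _ hφ hφ1] at hstep
      have hone : M.step o Set.univ ≤ 1 := by
        rw [Model.step, Measure.map_apply (by fun_prop) MeasurableSet.univ]
        exact particles_univ_le M o
      calc _ ≤ ∫⁻ o', 2 ^ (p - 1) * (‖∫ x, φ x ∂(gammaN o') -
              ∫ y, M.pullback u φ y ∂(Measure.pi fun v => gammaN (o v))‖ₑ ^ p + ‖D o‖ₑ ^ p)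
              ∂(M.step o) := lintegral_mono fun o' => enorm_sub_rpow_le hp _ _ _
        _ = 2 ^ (p - 1) * (∫⁻ o', ‖∫ x, φ x ∂(gammaN o') -
              ∫ y, M.pullback u φ y ∂(Measure.pi fun v => gammaN (o v))‖ₑ ^ p ∂(M.step o) +
                ‖D o‖ₑ ^ p * M.step o Set.univ) := by
            rw [lintegral_const_mul' _ _ (ENNReal.rpow_ne_top_of_nonneg (by linarith) (by simp)),
              lintegral_add_right _ measurable_const, lintegral_const]
        _ ≤ _ := by
            gcongr
            · exact hstep.trans (by gcongr)
            · exact mul_le_of_le_one_right' hone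
    have hD : ∫⁻ o, ‖D o‖ₑ ^ p ∂(Measure.pi fun v : Children u => M.run N v.1) ≤
        ENNReal.ofReal W ^ p * ((2 ^ p) ^ k * (((B : ℝ≥0∞) ^ k) ^ p *
          (↑(∑ v, c v) * rate p N))) := by
      simp only [D, hgamma]
      exact hpi.lintegral_le hp0 (measurable_pullback M u hφ) hW0 (abs_pullback_le M hW hφ1)
    refine (lintegral_mono_ae hcond).trans ?_
    rw [lintegral_const_mul' _ _ (ENNReal.rpow_ne_top_of_nonneg (by linarith) (by simp)),
      lintegral_add_left measurable_const, lintegral_const, measure_univ, mul_one]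
    calc _ ≤ 2 ^ (p - 1) * ((ENNReal.ofReal W * B ^ k) ^ p * (momentConst p * rate p N) +
          ENNReal.ofReal W ^ p * ((2 ^ p) ^ k * (((B : ℝ≥0∞) ^ k) ^ p *
            (↑(∑ v, c v) * rate p N)))) := by gcongr
      _ = C * rate p N := by simp only [C]; ring

end Model

/-! ### The `L^p` inequalities -/

lemma LpBound.of_lintegral_le {Ω : Type*} [MeasurableSpace Ω] {P : Measure Ω} {p : ℝ}
    (hp : 0 < p) {f : Ω → ℝ} (hf : Measurable f) {c : ℝ} (hc : 0 ≤ c)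
    (h : ∫⁻ ω, ‖f ω‖ₑ ^ p ∂P ≤ ENNReal.ofReal c ^ p) : LpBound P p f c := by
  have hm : Measurable fun ω => |f ω| ^ p := hf.abs.pow_const p
  have h0 : ∀ ω, 0 ≤ |f ω| ^ p := fun ω => Real.rpow_nonneg (abs_nonneg _) p
  have heq : ∀ ω, ‖f ω‖ₑ ^ p = ENNReal.ofReal (|f ω| ^ p) := fun ω => by
    rw [Real.enorm_eq_ofReal_abs, ENNReal.ofReal_rpow_of_nonneg (abs_nonneg _) hp.le]
  rw [lintegral_congr heq, ENNReal.ofReal_rpow_of_nonneg hc hp.le] at h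
  refine ⟨⟨hm.aestronglyMeasurable, ?_⟩, ?_⟩
  · rw [hasFiniteIntegral_iff_ofReal (ae_of_all _ h0)]
    exact h.trans_lt ENNReal.ofReal_lt_top
  · rw [integral_eq_lintegral_of_nonneg_ae (ae_of_all _ h0) hm.aestronglyMeasurable]
    have h' := ENNReal.toReal_mono ENNReal.ofReal_ne_top h
    rw [ENNReal.toReal_ofReal (Real.rpow_nonneg hc p)] at h'
    refine (Real.rpow_le_rpow ENNReal.toReal_nonneg h' (by positivity)).trans_eq ?_
    rw [← Real.rpow_mul hc, mul_one_div_cancel hp.ne', Real.rpow_one]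

section Model

variable {T : RootedTree} [Finite T] {E : T → Type*} [∀ u, MeasurableSpace (E u)] (M : Model T E)

lemma isFiniteMeasure_ρN (h2 : M.BddWeights) {N : ℕ} {u : T} (o : Output E N u) :
    IsFiniteMeasure (M.ρN o) := by
  obtain ⟨W, -, hW⟩ := exists_nonneg_forall_le (h2.w_bdd u)
  exact isFiniteMeasure_reweigh hW _

lemma measurable_integral_ρN (h2 : M.BddWeights) {N : ℕ} {u : T} {φ : SubtreeSpace E u → ℝ}
    (hφ : Measurable φ) {c : ℝ} (hc : ∀ x, |φ x| ≤ c) :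
    Measurable fun o : Output E N u => ∫ x, φ x ∂(M.ρN o) := by
  have := fun o : Output E N u => isFiniteMeasure_ρN M h2 o
  exact measurable_integral_measure (κ := M.ρN)
    (measurable_reweigh measurable_gammaN (M.measurable_w u)) hφ hc

/-- The `L^p` inequality for `ρ_u^N`. -/
theorem exists_lintegral_ρN_le (h1 : M.AbsCont) (h2 : M.BddWeights) {p : ℝ} (hp : 1 ≤ p) (u : T) :
    ∃ C : ℝ, 0 ≤ C ∧ ∀ N, 0 < N → ∀ (φ : SubtreeSpace E u → ℝ) (c : ℝ), Measurable φ → 0 ≤ c →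
      (∀ x, |φ x| ≤ c) →
        ∫⁻ o, ‖∫ x, φ x ∂(M.ρN o) - ∫ x, φ x ∂(M.ρ u)‖ₑ ^ p ∂(M.run N u) ≤
          ENNReal.ofReal (C * c / √N) ^ p := by
  have hp0 : 0 < p := by linarith
  obtain ⟨C, hC⟩ := exists_momentBound_gamma M h1 h2 hp u
  obtain ⟨W, hW0, hW⟩ := exists_nonneg_forall_le (h2.w_bdd u)
  have hw0 : ∀ x, 0 ≤ M.w u x := fun x => (h1.w_pos u x).le
  refine ⟨W * (C : ℝ) ^ (1 / p), by positivity, fun N hN φ c hφ hc hφc => ?_⟩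
  rw [h1.ρ_eq u]
  simp only [Model.ρN, integral_reweigh (M.measurable_w u) hw0]
  refine ((hC N hN).lintegral_le hp0 ((M.measurable_w u).mul hφ) (mul_nonneg hW0 hc) fun x => by
    rw [Pi.mul_apply, abs_mul]; exact mul_le_mul (hW x) (hφc x) (abs_nonneg _) hW0).trans (le_of_eq ?_)
  have hCp : (C : ℝ≥0∞) = ENNReal.ofReal ((C : ℝ) ^ (1 / p)) ^ p := by
    rw [ENNReal.ofReal_rpow_of_nonneg (by positivity) hp0.le, ← Real.rpow_mul C.coe_nonneg,
      one_div_mul_cancel hp0.ne', Real.rpow_one, ENNReal.ofReal_coe_nnreal]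
  rw [hCp, rate, ← ENNReal.mul_rpow_of_nonneg _ _ hp0.le, ← ENNReal.mul_rpow_of_nonneg _ _ hp0.le,
    ← ENNReal.ofReal_mul (by positivity), ← ENNReal.ofReal_mul (by positivity)]
  congr 2
  ring

lemma reweigh_ne_zero {X : Type*} [MeasurableSpace X] {w : X → ℝ} (hw : Measurable w)
    (h0 : ∀ x, 0 < w x) {m : Measure X} (hm : m ≠ 0) : reweigh w m ≠ 0 := by
  intro h
  have hac : m ≪ reweigh w m := withDensity_absolutelyContinuous' hw.ennreal_ofReal.aemeasurable
    (ae_of_all _ fun x => (ENNReal.ofReal_pos.2 (h0 x)).ne')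
  rw [h] at hac
  exact hm (Measure.absolutelyContinuous_zero_iff.1 hac)

lemma gamma_ne_zero (h1 : M.AbsCont) (u : T) : M.gamma u ≠ 0 := by
  induction u using (wellFounded_gt (α := T)).induction with
  | _ u ih =>
  by_cases hu : IsMax u
  · have := isProb_gamma_leaf M hu
    exact IsProbabilityMeasure.ne_zero _
  · have := M.markov_K u
    have := M.finite_aux u
    have hC : M.gammaC u ≠ 0 := by
      rw [Model.gammaC, Ne, Measure.map_eq_zero_iff (measurable_glue u).aemeasurable,
        ← Measure.measure_univ_eq_zero, Measure.pi_univ, Finset.prod_eq_zero_iff]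
      rintro ⟨v, -, hv⟩
      exact ih v.1 v.2.lt (Measure.measure_univ_eq_zero.1 hv)
    have haux : M.aux u ≠ 0 := by
      rw [h1.aux_eq u hu]
      exact reweigh_ne_zero (M.measurable_wAux u) (h1.wAux_pos u hu) hC
    rw [Model.gamma, dif_neg hu, Ne, Measure.map_eq_zero_iff (measurable_join u).aemeasurable,
      ← Measure.measure_univ_eq_zero, Measure.compProd_apply_univ]
    exact fun h => haux (Measure.measure_univ_eq_zero.1 h)

lemma Z_pos (h1 : M.AbsCont) (u : T) : 0 < M.Z u := by
  have := M.finite_ρ u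
  have hρ : M.ρ u ≠ 0 := by
    rw [h1.ρ_eq u]
    exact reweigh_ne_zero (M.measurable_w u) (h1.w_pos u) (gamma_ne_zero M h1 u)
  exact ENNReal.toReal_pos (Measure.measure_univ_ne_zero.2 hρ) (measure_ne_top _ _)

/-- Normalization: `μ_u^N(φ)` is a ratio of two estimators, and `|μ_u^N(φ)| ≤ ‖φ‖` because the
weights are positive. If `Z_u^N = 0`, then `μ_u^N(φ) = ρ_u^N(φ) = 0`. -/
lemma abs_μN_sub_le (h1 : M.AbsCont) (h2 : M.BddWeights) {N : ℕ} {u : T} (o : Output E N u)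
    {φ : SubtreeSpace E u → ℝ} {c : ℝ} (hc : 0 ≤ c) (hφc : ∀ x, |φ x| ≤ c) :
    |∫ x, φ x ∂(M.μN o) - ∫ x, φ x ∂(M.μ u)| ≤
      (M.Z u)⁻¹ * (|∫ x, φ x ∂(M.ρN o) - ∫ x, φ x ∂(M.ρ u)| + c * |M.ZN o - M.Z u|) := by
  have := isFiniteMeasure_ρN M h2 o
  have hZ := Z_pos M h1 u
  rw [Model.μN, Model.μ, integral_normalized, integral_normalized]
  change |(M.ZN o)⁻¹ * _ - (M.Z u)⁻¹ * _| ≤ _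
  have hb : |∫ x, φ x ∂(M.ρN o)| ≤ c * M.ZN o := abs_integral_le hφc
  generalize M.ZN o = z at *
  generalize M.Z u = Z at *
  generalize ∫ x, φ x ∂(M.ρN o) = a at *
  generalize ∫ x, φ x ∂(M.ρ u) = b at *
  have hr : |z⁻¹ * a| ≤ c := by
    rcases eq_or_ne z 0 with rfl | hz
    · simpa using hc
    · rw [abs_mul, abs_inv, inv_mul_le_iff₀ (abs_pos.2 hz), mul_comm]
      exact hb.trans (mul_le_mul_of_nonneg_left (le_abs_self z) hc)
  have ha : z * (z⁻¹ * a) = a := by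
    rcases eq_or_ne z 0 with rfl | hz
    · have : a = 0 := by simpa using hb
      simp [this]
    · rw [mul_inv_cancel_left₀ hz]
  have key : z⁻¹ * a - Z⁻¹ * b = Z⁻¹ * ((a - b) - (z⁻¹ * a) * (z - Z)) := by
    have : Z⁻¹ * ((a - b) - (z⁻¹ * a) * (z - Z)) =
      Z⁻¹ * (a - z * (z⁻¹ * a)) - Z⁻¹ * b + (Z⁻¹ * Z) * (z⁻¹ * a) := by ring
    rw [this, ha, inv_mul_cancel₀ hZ.ne']
    ring
  rw [key, abs_mul, abs_of_pos (inv_pos.2 hZ)]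
  gcongr
  refine (abs_sub _ _).trans ?_
  rw [abs_mul (z⁻¹ * a)]
  gcongr

/-- The `L^p` inequality for `μ_u^N`, given the one for `ρ_u^N`. -/
lemma lintegral_μN_le (h1 : M.AbsCont) (h2 : M.BddWeights) {p : ℝ} (hp : 1 ≤ p) {N : ℕ} {u : T}
    {φ : SubtreeSpace E u → ℝ} (hφ : Measurable φ) {c : ℝ} (hc : 0 ≤ c) (hφc : ∀ x, |φ x| ≤ c)
    {d : ℝ} (hρ : ∫⁻ o, ‖∫ x, φ x ∂(M.ρN o) - ∫ x, φ x ∂(M.ρ u)‖ₑ ^ p ∂(M.run N u) ≤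
      ENNReal.ofReal (d * c) ^ p)
    (hZN : ∫⁻ o, ‖M.ZN o - M.Z u‖ₑ ^ p ∂(M.run N u) ≤ ENNReal.ofReal d ^ p) :
    ∫⁻ o, ‖∫ x, φ x ∂(M.μN o) - ∫ x, φ x ∂(M.μ u)‖ₑ ^ p ∂(M.run N u) ≤
      ENNReal.ofReal (2 * (M.Z u)⁻¹ * (d * c)) ^ p := by
  have hp0 : 0 < p := by linarith
  have hZ := Z_pos M h1 u
  set A := ENNReal.ofReal (M.Z u)⁻¹
  have htop : ∀ a : ℝ, ENNReal.ofReal a ^ p ≠ ∞ := fun a =>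
    ENNReal.rpow_ne_top_of_nonneg hp0.le ENNReal.ofReal_ne_top
  have hpt : ∀ o : Output E N u, ‖∫ x, φ x ∂(M.μN o) - ∫ x, φ x ∂(M.μ u)‖ₑ ^ p ≤
      A ^ p * (2 ^ (p - 1) * (‖∫ x, φ x ∂(M.ρN o) - ∫ x, φ x ∂(M.ρ u)‖ₑ ^ p +
        ENNReal.ofReal c ^ p * ‖M.ZN o - M.Z u‖ₑ ^ p)) := by
    intro o
    rw [← ENNReal.mul_rpow_of_nonneg _ _ hp0.le]
    refine le_trans ?_ (mul_le_mul_right (ENNReal.rpow_add_le_mul_rpow_add_rpow _ _ hp) _)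
    rw [← ENNReal.mul_rpow_of_nonneg _ _ hp0.le]
    refine ENNReal.rpow_le_rpow ?_ hp0.le
    simp only [Real.enorm_eq_ofReal_abs, A]
    rw [← ENNReal.ofReal_mul hc, ← ENNReal.ofReal_add (by positivity) (by positivity),
      ← ENNReal.ofReal_mul (by positivity)]
    exact ENNReal.ofReal_le_ofReal (abs_μN_sub_le M h1 h2 o hc hφc)
  have hmeas : Measurable fun o : Output E N u =>
      ‖∫ x, φ x ∂(M.ρN o) - ∫ x, φ x ∂(M.ρ u)‖ₑ ^ p :=
    ((measurable_integral_ρN M h2 hφ hφc).sub_const _).enorm.pow_const p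
  calc _ ≤ _ := lintegral_mono hpt
    _ = A ^ p * (2 ^ (p - 1) *
          (∫⁻ o, ‖∫ x, φ x ∂(M.ρN o) - ∫ x, φ x ∂(M.ρ u)‖ₑ ^ p ∂(M.run N u) +
            ENNReal.ofReal c ^ p * ∫⁻ o, ‖M.ZN o - M.Z u‖ₑ ^ p ∂(M.run N u))) := by
        rw [lintegral_const_mul' _ _ (htop _), lintegral_const_mul' _ _
          (ENNReal.rpow_ne_top_of_nonneg (by linarith) (by simp)), lintegral_add_left hmeas,
          lintegral_const_mul' _ _ (htop _)]
    _ ≤ A ^ p * (2 ^ (p - 1) *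
          (ENNReal.ofReal (d * c) ^ p + ENNReal.ofReal c ^ p * ENNReal.ofReal d ^ p)) := by gcongr
    _ = _ := by
        rw [← ENNReal.mul_rpow_of_nonneg _ _ hp0.le, ← ENNReal.ofReal_mul hc, mul_comm c d,
          ← two_mul, ← mul_assoc (2 ^ (p - 1)), two_rpow_sub_one_mul_two,
          ← ENNReal.mul_rpow_of_nonneg _ _ hp0.le, ← ENNReal.mul_rpow_of_nonneg _ _ hp0.le]
        congr 1
        rw [ENNReal.ofReal_mul (by positivity : 0 ≤ 2 * (M.Z u)⁻¹),
          ENNReal.ofReal_mul zero_le_two, ENNReal.ofReal_ofNat]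
        ring

end Model

end DaC

end

theorem mainTheorem2 {T : RootedTree} [Finite T] {E : T → Type*} [∀ u, MeasurableSpace (E u)]
    (M : DaC.Model T E) (h1 : M.AbsCont) (h2 : M.BddWeights) (p : ℝ) (hp : 1 ≤ p) (u : T) :
    ∃ Cρ Cμ : ℝ, ∀ N : ℕ, 0 < N →
      (∀ φ : DaC.SubtreeSpace E u → ℝ, DaC.IsBddMeasurable φ →
        DaC.LpBound (M.run N u) p (fun o => (∫ x, φ x ∂(M.ρN o)) - ∫ x, φ x ∂(M.ρ u))
          (Cρ * DaC.supNorm φ / Real.sqrt N) ∧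
        DaC.LpBound (M.run N u) p (fun o => (∫ x, φ x ∂(M.μN o)) - ∫ x, φ x ∂(M.μ u))
          (Cμ * DaC.supNorm φ / Real.sqrt N)) ∧
      DaC.LpBound (M.run N u) p (fun o => M.ZN o - M.Z u) (Cρ / Real.sqrt N) := by
  have hp0 : 0 < p := by linarith
  have hZ := DaC.Z_pos M h1 u
  obtain ⟨C, hC0, hC⟩ := DaC.exists_lintegral_ρN_le M h1 h2 hp u
  refine ⟨C, 2 * (M.Z u)⁻¹ * C, fun N hN => ?_⟩
  have h1meas : Measurable fun o : DaC.Output E N u => M.ZN o := by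
    simpa [DaC.Model.ZN] using DaC.measurable_integral_ρN M h2 (N := N) (u := u) (φ := fun _ => 1)
      measurable_const (c := 1) (by simp)
  have hZN : ∫⁻ o, ‖M.ZN o - M.Z u‖ₑ ^ p ∂(M.run N u) ≤ ENNReal.ofReal (C / √N) ^ p := by
    simpa [DaC.Model.ZN, DaC.Model.Z] using hC N hN (fun _ => 1) 1 measurable_const zero_le_one
      (by simp)
  refine ⟨fun φ ⟨hφ, hb⟩ => ?_,
    DaC.LpBound.of_lintegral_le hp0 (h1meas.sub_const _) (by positivity) hZN⟩
  have hφc : ∀ x, |φ x| ≤ DaC.supNorm φ := fun x => le_ciSup hb x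
  have hc : 0 ≤ DaC.supNorm φ := Real.iSup_nonneg fun x => abs_nonneg _
  have hm := DaC.measurable_integral_ρN M h2 (N := N) hφ hφc
  have hρ := hC N hN φ _ hφ hc hφc
  refine ⟨DaC.LpBound.of_lintegral_le hp0 (hm.sub_const _) (by positivity) hρ,
    DaC.LpBound.of_lintegral_le hp0 ?_ (by positivity) ?_⟩
  · simp only [DaC.Model.μN, DaC.integral_normalized]
    exact (h1meas.inv.mul hm).sub_const _
  · rw [mul_div_right_comm C] at hρ
    refine (DaC.lintegral_μN_le M h1 h2 hp hφ hc hφc hρ hZN).trans_eq ?_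
    congr 2
    ring
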